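/- **Theorem (Busy Time).** Let $l\ge 1$ be an integer and $\epsilon\in[0,1]$. Packets are sent in slots $t=1,2,3,\dots$; slot $t$ carries a coded packet if $l\mid t$ and an information packet otherwise, so that one coded packet follows every $l-1$ information packets. Each packet is erased with probability $\epsilon$, independently of all others. Each received coded packet repairs one erasure: information packets are delivered in order until an information packet is erased; this pauses delivery, and delivery resumes at the first slot by which the number of coded packets received since the pause began equals the number of information packets erased since then (inclusive of the erasure that caused the pause). Divide the stream into consecutive periods, the first beginning after slot $0$. Let a period begin after slot $\tau$. If no information packet is erased in slots $\tau+1,\dots,\tau+l$, the period is idle, consists of these $l$ slots, and its busy time is $0$. Otherwise it is busy, it ends at the slot $T$ at which delivery, paused by the first of these erasures, resumes, and its busy time is $(T-\tau)/l$, the number of coded packets sent until delivery resumes (with $T=\infty$ and busy time $\infty$ if delivery never resumes). The next period begins after the last slot of the current one. Let $S_j$ be the busy time of the $j$-th period ($S_j=\infty$ if there is no $j$-th period because an earlier one never ends). Put $$p_S(s)=\begin{cases}(1-\epsilon)^{l-1}& s=0,\\ (l-1)\,\epsilon(1-\epsilon)^{l-1}& s=1,\\ \dfrac{l-1}{s}\,\epsilon^{s}(1-\epsilon)^{s(l-1)}\dbinom{(s-1)l}{s-1}&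 s>1.\end{cases}$$ Then for every $j\ge 1$ and $S=S_j$: I. If $l\epsilon<1$, then $E(S)$ is finite. II. For every $\epsilon\in[0,1]$ and every integer $s\ge 0$, $P(S_j=s)=p_S(s)\cdot P(\text{there is a } j\text{-th period})$. If $l\epsilon\le 1$, then $S$ is finite almost surely and $P(S=s)=p_S(s)$ for every integer $s\ge0$. III. If $l\epsilon<1$, then $$E(S)=\frac{(l-1)\,\epsilon(1-\epsilon)^{l-1}}{1-l\epsilon},\qquad E(S^2)=E(S)+\frac{l(l-1)\,\epsilon^2(1-\epsilon)^l}{(1-l\epsilon)^3}.$$ -/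

import Mathlib

noncomputable section

/-!
Slots are numbered 1, 2, 3, ...  A slot is a coded slot if its number is a multiple of `l`,
and an information slot otherwise, so each coded packet follows `l - 1` information packets.
`E : Set ℕ` is the set of erased slots of one realisation of the channel.
-/

namespace LowDelayCode

/-- The first element of a set of slots, with value `⊤` if the set is empty. -/
def firstSlot (A : Set ℕ) : ℕ∞ := ⨅ t ∈ A, (t : ℕ∞)

open Classical in
/-- The number of erased information packets in the slots `a, ..., b`. -/
def erasedInfo (l : ℕ) (E : Set ℕ) (a b : ℕ) : ℕ :=
  ((Finset.Icc a b).filter (fun t => ¬ l ∣ t ∧ t ∈ E)).card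

open Classical in
/-- The number of coded packets received in the slots `a, ..., b`. -/
def receivedCoded (l : ℕ) (E : Set ℕ) (a b : ℕ) : ℕ :=
  ((Finset.Icc a b).filter (fun t => l ∣ t ∧ t ∉ E)).card

/-- If packets are being delivered in order at the end of slot `τ`, this is the slot of the next
pause: the first later slot in which an information packet is erased. -/
def pauseSlot (l : ℕ) (E : Set ℕ) (τ : ℕ) : ℕ∞ :=
  firstSlot {t | τ < t ∧ ¬ l ∣ t ∧ t ∈ E}

/-- The slot at which a pause that began with the erasure in slot `p` ends: the first one by which
as many coded packets have been received since the pause began as information packets have been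
erased. This is where the assumption enters that each received coded packet repairs one erasure. -/
def resumeSlot (l : ℕ) (E : Set ℕ) (p : ℕ) : ℕ∞ :=
  firstSlot {t | p < t ∧ receivedCoded l E p t = erasedInfo l E p t}

/-- The period that begins after slot `τ` (with `τ = 0` or `τ` a coded slot, in-order delivery being
active) is busy if an information packet is erased in one of the next `l` slots; otherwise
it is idle. -/
def IsBusy (l : ℕ) (E : Set ℕ) (τ : ℕ) : Prop :=
  pauseSlot l E τ ≤ ((τ + l : ℕ) : ℕ∞)

open Classical in
/-- The last slot of the period that begins after slot `τ`: the slot at which in-order delivery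
resumes for a busy period (`⊤` if it never does), and `τ + l` for an idle one. -/
def periodEnd (l : ℕ) (E : Set ℕ) (τ : ℕ) : ℕ∞ :=
  if IsBusy l E τ then resumeSlot l E (pauseSlot l E τ).toNat else ((τ + l : ℕ) : ℕ∞)

open Classical in
/-- The value `S` of the period that begins after slot `τ`: `0` for an idle period and `(T - τ) / l`
for a busy period at whose end `T` delivery resumes (`⊤` if it never does). -/
def periodValue (l : ℕ) (E : Set ℕ) (τ : ℕ) : ℕ∞ :=
  if IsBusy l E τ then (periodEnd l E τ).map (fun T => (T - τ) / l) else 0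

/-- The `j`-th period (`j = 0, 1, 2, ...`) consists of slots after `periodStart l E j`; the first one
begins after slot `0` and each later one after the end of its predecessor. The value is `⊤`
if there is no `j`-th period because an earlier one never ends. -/
def periodStart (l : ℕ) (E : Set ℕ) : ℕ → ℕ∞
  | 0 => 0
  | j + 1 =>
    if periodStart l E j = ⊤ then ⊤ else periodEnd l E (periodStart l E j).toNat

/-- The busy time `S_j` of the `j`-th period, with the convention `⊤` if there is no
`j`-th period. -/
def busyTime (l : ℕ) (E : Set ℕ) (j : ℕ) : ℕ∞ :=
  if periodStart l E j = ⊤ then ⊤ else periodValue l E (periodStart l E j).toNat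

/-- The set of erased slots at the sample point `ω`, where `e t` is the event that slot `t` is
erased. -/
def erasedSlots {Ω : Type*} (e : ℕ → Set Ω) (ω : Ω) : Set ℕ := {t | ω ∈ e t}

/-- The claimed probability mass function of the busy time. -/
def busyPmf (l : ℕ) (ε : ℝ) (s : ℕ) : ℝ :=
  if s = 0 then (1 - ε) ^ (l - 1)
  else if s = 1 then ((l : ℝ) - 1) * ε * (1 - ε) ^ (l - 1)
  else ((l : ℝ) - 1) / s * ε ^ s * (1 - ε) ^ (s * (l - 1)) * (((s - 1) * l).choose (s - 1) : ℝ)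

end LowDelayCode

end

/-!
The `l` slots of a block together have a binomial number `Z` of erasures. A block raises the backlog
of erased information packets over received coded ones by `Z - 1`, whichever slots are erased,
because an erased coded slot counts as one coded packet missed. Inside a pause the backlog can
vanish only at a coded slot, so a busy period ends with a block, and its busy time is governed by
the time at which a random walk with independent steps `Z - 1 ≥ -1` first reaches `0`
(`periodValue_eq_succ_iff`). The one discrepancy is a first block whose only erased slot is the
coded one: the walk is back at once, but the period is idle (`busyPmf_succ`).

For the law of the hitting time, conditioning on the first step gives a recursion (`hitProb`), which
Kemperman's formula solves (`mul_hitProb`); the induction step is Vandermonde's convolution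
together with its first moment. Averaging it over the first block gives `p_S`
(`mul_excursionProb`). The start of a period depends only on the slots before it and its busy time
only on the slots after it, which gives the law of every period (`measure_busyTime_eq`).

For the total mass and the moments, the walk goes down by at most one at a time, so the hitting time
from `k` is a sum of `k` independent copies of that from `1` (`hitProb_add`). Hence the probability
`q` to reach `0` from `1` satisfies `q = (ε * q + 1 - ε) ^ l`, and Bernoulli's inequality forces
`q = 1` for `l * ε ≤ 1`, except that for `l = 1`, `ε = 1` the walk stands still; there are no
information packets when `l = 1`, and the busy time is `0`. For `l * ε < 1` quadratic
supersolutions bound the first two moments (`sum_range_mul_hitProb_le`), and the same first-step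
equation then determines them.
-/

namespace LowDelayCode

open Finset.HasAntidiagonal (antidiagonal mem_antidiagonal)

/-! ### Periods in terms of erasure counts -/

open Classical in
/-- The number of erased slots, coded or not, among the `n` slots `a + 1, ..., a + n`. -/
noncomputable def erasures (E : Set ℕ) (a n : ℕ) : ℕ :=
  ∑ i ∈ Finset.range n, if a + i + 1 ∈ E then 1 else 0

/-- The walk that starts at height `k` and takes the step `Z - 1` in each of the blocks
`b, b + 1, ...`, where `Z` is the number of erased slots of the block and block `b` consists of the
slots `b * l + 1, ..., b * l + l`, reaches `0` for the first time after exactly `n` blocks. -/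
def Hits (l : ℕ) (E : Set ℕ) (n b k : ℕ) : Prop :=
  (∀ i < n, i < k + erasures E (b * l) (i * l)) ∧ k + erasures E (b * l) (n * l) = n

theorem erasures_add (E : Set ℕ) (a m n : ℕ) :
    erasures E a (m + n) = erasures E a m + erasures E (a + m) n := by
  simp only [erasures, Finset.sum_range_add]
  congr 1
  exact Finset.sum_congr rfl fun i _ => by rw [add_assoc a m i]

open Classical in
theorem erasures_succ (E : Set ℕ) (a n : ℕ) :
    erasures E a (n + 1) = erasures E a n + if a + n + 1 ∈ E then 1 else 0 := by
  simp only [erasures, Finset.sum_range_succ]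

theorem erasures_le (E : Set ℕ) (a n : ℕ) : erasures E a n ≤ n := by
  induction n with
  | zero => simp [erasures]
  | succ n ih => rw [erasures_succ]; split_ifs <;> omega

theorem erasures_pos_iff {E : Set ℕ} {a n : ℕ} :
    0 < erasures E a n ↔ ∃ i < n, a + i + 1 ∈ E := by
  simp only [erasures, Finset.sum_pos_iff, Finset.mem_range]
  refine exists_congr fun i => and_congr_right fun _ => ?_
  split_ifs with h <;> simp [h]

theorem hits_zero {l : ℕ} {E : Set ℕ} {b k : ℕ} : Hits l E 0 b k ↔ k = 0 := by
  simp [Hits, erasures]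

theorem not_hits_succ_zero {l : ℕ} {E : Set ℕ} {n b : ℕ} : ¬ Hits l E (n + 1) b 0 := by
  intro h
  simpa [erasures] using h.1 0 (Nat.succ_pos n)

theorem erasures_block_succ (l : ℕ) (E : Set ℕ) (b i : ℕ) :
    erasures E (b * l) ((i + 1) * l) =
      erasures E (b * l) l + erasures E ((b + 1) * l) (i * l) := by
  rw [show (i + 1) * l = l + i * l by ring, erasures_add, show b * l + l = (b + 1) * l by ring]

theorem hits_succ_succ {l : ℕ} {E : Set ℕ} {n b k : ℕ} :
    Hits l E (n + 1) b (k + 1) ↔ Hits l E n (b + 1) (k + erasures E (b * l) l) := by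
  unfold Hits
  rw [erasures_block_succ]
  constructor
  · rintro ⟨h, h'⟩
    refine ⟨fun i hi => ?_, by omega⟩
    have := h (i + 1) (by omega)
    rw [erasures_block_succ] at this
    omega
  · rintro ⟨h, h'⟩
    refine ⟨fun i hi => ?_, by omega⟩
    cases i with
    | zero => omega
    | succ i =>
      have := h i (by omega)
      rw [erasures_block_succ]
      omega

theorem firstSlot_le_coe_iff {A : Set ℕ} {n : ℕ} :
    firstSlot A ≤ (n : ℕ∞) ↔ ∃ t ∈ A, t ≤ n := by
  constructor
  · intro h
    by_contra! hA
    have : ((n + 1 : ℕ) : ℕ∞) ≤ firstSlot A :=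
      le_iInf₂ fun t ht => by exact_mod_cast hA t ht
    have := this.trans h
    norm_cast at this
    omega
  · rintro ⟨t, ht, htn⟩
    exact (iInf₂_le t ht).trans (by exact_mod_cast htn)

theorem firstSlot_eq_coe_iff {A : Set ℕ} {n : ℕ} :
    firstSlot A = (n : ℕ∞) ↔ IsLeast A n := by
  constructor
  · intro h
    have hlow : n ∈ lowerBounds A := fun t ht => by
      have : firstSlot A ≤ (t : ℕ∞) := iInf₂_le t ht
      rw [h] at this
      exact_mod_cast this
    obtain ⟨t, ht, htn⟩ := firstSlot_le_coe_iff.1 h.le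
    exact ⟨(le_antisymm (hlow ht) htn) ▸ ht, hlow⟩
  · rintro ⟨hn, hlow⟩
    exact le_antisymm (iInf₂_le n hn) (le_iInf₂ fun t ht => by exact_mod_cast hlow ht)

open Classical in
theorem erasedInfo_succ {l : ℕ} {E : Set ℕ} {a t : ℕ} (h : a ≤ t + 1) :
    erasedInfo l E a (t + 1) =
      erasedInfo l E a t + if ¬ l ∣ t + 1 ∧ t + 1 ∈ E then 1 else 0 := by
  unfold erasedInfo
  rw [← Finset.insert_Icc_right_eq_Icc_add_one h, Finset.filter_insert]
  split_ifs
  · rw [Finset.card_insert_of_notMem (by simp)]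
  · rfl

open Classical in
theorem receivedCoded_succ {l : ℕ} {E : Set ℕ} {a t : ℕ} (h : a ≤ t + 1) :
    receivedCoded l E a (t + 1) =
      receivedCoded l E a t + if l ∣ t + 1 ∧ t + 1 ∉ E then 1 else 0 := by
  unfold receivedCoded
  rw [← Finset.insert_Icc_right_eq_Icc_add_one h, Finset.filter_insert]
  split_ifs
  · rw [Finset.card_insert_of_notMem (by simp)]
  · rfl

theorem erasedInfo_mono {l : ℕ} {E : Set ℕ} {a s t : ℕ} (h : s ≤ t) :
    erasedInfo l E a s ≤ erasedInfo l E a t := by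
  classical
  exact Finset.card_le_card (Finset.filter_subset_filter _ (Finset.Icc_subset_Icc_right h))

theorem dvd_block_add_succ {l b m : ℕ} : l ∣ b * l + m + 1 ↔ l ∣ m + 1 := by
  rw [add_assoc]
  exact (Nat.dvd_add_iff_right (Dvd.intro_left b rfl)).symm

/-- Every coded slot is either received or one of the erased slots, so the backlog of erased
information packets over received coded packets is the number of all erasures minus the number
of coded slots. -/
theorem erasedInfo_add_div (l : ℕ) (E : Set ℕ) (b m : ℕ) :
    erasedInfo l E (b * l + 1) (b * l + m) + m / l =
      receivedCoded l E (b * l + 1) (b * l + m) + erasures E (b * l) m := by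
  induction m with
  | zero => simp [erasedInfo, receivedCoded, erasures]
  | succ m ih =>
    rw [← add_assoc, erasedInfo_succ (by omega), receivedCoded_succ (by omega), erasures_succ,
      Nat.succ_div]
    have hd : l ∣ b * l + m + 1 ↔ l ∣ m + 1 := dvd_block_add_succ
    by_cases h1 : l ∣ m + 1 <;> by_cases h2 : b * l + m + 1 ∈ E <;>
      simp [h1, h2, hd.2, mt hd.1] <;> omega

theorem receivedCoded_add_eq {l : ℕ} {E : Set ℕ} {a b r : ℕ} (ha : a ≤ b * l + 1) (hr : r < l) :
    receivedCoded l E a (b * l + r) = receivedCoded l E a (b * l) := by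
  induction r with
  | zero => rfl
  | succ r ih =>
    rw [← add_assoc, receivedCoded_succ (by omega), ih (by omega), if_neg, add_zero]
    rw [dvd_block_add_succ]
    exact fun h => Nat.not_dvd_of_pos_of_lt (Nat.succ_pos r) hr h.1

theorem isBusy_iff {l : ℕ} (hl : 1 ≤ l) {E : Set ℕ} {b : ℕ} :
    IsBusy l E (b * l) ↔ 0 < erasures E (b * l) (l - 1) := by
  rw [IsBusy, pauseSlot, firstSlot_le_coe_iff, erasures_pos_iff]
  constructor
  · rintro ⟨t, ⟨ht, hlt, htE⟩, htl⟩
    obtain ⟨i, rfl⟩ : ∃ i, t = b * l + i + 1 := ⟨t - b * l - 1, by omega⟩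
    refine ⟨i, ?_, htE⟩
    rw [dvd_block_add_succ] at hlt
    have : i + 1 ≠ l := fun h => hlt (by rw [h])
    omega
  · rintro ⟨i, hi, hE⟩
    refine ⟨_, ⟨by omega, ?_, hE⟩, by omega⟩
    rw [dvd_block_add_succ]
    exact Nat.not_dvd_of_pos_of_lt (Nat.succ_pos i) (by omega)

/-- A busy period that begins with block `b` ends after a whole number of blocks, namely when the
walk, standing at `Z - 1` after the first block, reaches `0`. -/
theorem periodEnd_eq_coe_iff {l : ℕ} (hl : 1 ≤ l) {E : Set ℕ} {b T : ℕ}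
    (hb : IsBusy l E (b * l)) :
    periodEnd l E (b * l) = (T : ℕ∞) ↔
      ∃ n, T = (b + n + 1) * l ∧ Hits l E n (b + 1) (erasures E (b * l) l - 1) := by
  classical
  have hZ : 0 < erasures E (b * l) l := by
    obtain ⟨i, hi, hE⟩ := erasures_pos_iff.1 ((isBusy_iff hl).1 hb)
    exact erasures_pos_iff.2 ⟨i, by omega, hE⟩
  obtain ⟨p, hp⟩ : ∃ p : ℕ, pauseSlot l E (b * l) = p := by
    refine ⟨_, (ENat.natCast_toNat ?_).symm⟩
    exact ne_top_of_le_ne_top (ENat.natCast_ne_top _) hb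
  have hpl : p ≤ b * l + l := by
    have : IsBusy l E (b * l) := hb
    rw [IsBusy, hp] at this
    exact_mod_cast this
  rw [periodEnd, if_pos hb, hp, ENat.toNat_natCast, resumeSlot, firstSlot_eq_coe_iff]
  obtain ⟨⟨hbp, hlp, hpE⟩, hmin⟩ := firstSlot_eq_coe_iff.1 hp
  have hpl' : p < b * l + l := by
    refine lt_of_le_of_ne hpl fun h => hlp ?_
    rw [h, ← Nat.succ_mul]
    exact Dvd.intro_left _ rfl
  -- Counting from the start of the period changes nothing: there is no erased information packet
  -- and no coded slot before `p`.
  have hD : ∀ t, erasedInfo l E p t = erasedInfo l E (b * l + 1) t := by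
    intro t
    unfold erasedInfo
    congr 1
    ext u
    simp only [Finset.mem_filter, Finset.mem_Icc]
    refine ⟨fun h => ⟨⟨by omega, h.1.2⟩, h.2⟩, fun h => ⟨⟨hmin ⟨by omega, h.2⟩, h.1.2⟩, h.2⟩⟩
  have hR : ∀ t, receivedCoded l E p t = receivedCoded l E (b * l + 1) t := by
    intro t
    unfold receivedCoded
    congr 1
    ext u
    simp only [Finset.mem_filter, Finset.mem_Icc]
    refine ⟨fun h => ⟨⟨by omega, h.1.2⟩, h.2⟩, fun h => ⟨⟨?_, h.1.2⟩, h.2⟩⟩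
    by_contra! hup
    obtain ⟨i, rfl⟩ : ∃ i, u = b * l + i + 1 := ⟨u - b * l - 1, by omega⟩
    have := h.2.1
    rw [dvd_block_add_succ] at this
    exact Nat.not_dvd_of_pos_of_lt (Nat.succ_pos i) (by omega) this
  simp only [hD, hR]
  have hR0 : ∀ r < l, receivedCoded l E (b * l + 1) (b * l + r) = 0 := by
    intro r hr
    rw [receivedCoded_add_eq le_rfl hr]
    simp [receivedCoded]
  have hDp : ∀ t, p ≤ t → 0 < erasedInfo l E (b * l + 1) t := by
    intro t ht
    refine Finset.card_pos.2 ⟨p, ?_⟩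
    simp only [Finset.mem_filter, Finset.mem_Icc]
    exact ⟨⟨hbp, ht⟩, hlp, hpE⟩
  have hbal : ∀ i, erasedInfo l E (b * l + 1) ((b + i + 1) * l) + (i + 1) =
      receivedCoded l E (b * l + 1) ((b + i + 1) * l) +
        (erasures E (b * l) l + erasures E ((b + 1) * l) (i * l)) := by
    intro i
    have := erasedInfo_add_div l E b ((i + 1) * l)
    rw [Nat.mul_div_cancel _ hl, erasures_block_succ, ← add_mul, ← add_assoc] at this
    exact this
  constructor
  · rintro ⟨⟨hpT, hT⟩, hTmin⟩
    have hlt : ∀ t, p ≤ t → t < T →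
        receivedCoded l E (b * l + 1) t < erasedInfo l E (b * l + 1) t := by
      intro t hpt
      induction t, hpt using Nat.le_induction with
      | base =>
        intro _
        obtain ⟨r, rfl⟩ : ∃ r, p = b * l + r := ⟨p - b * l, by omega⟩
        rw [hR0 r (by omega)]
        exact hDp _ le_rfl
      | succ t hpt ih =>
        intro htT
        have h1 := ih (by omega)
        have h2 : receivedCoded l E (b * l + 1) (t + 1) ≠ erasedInfo l E (b * l + 1) (t + 1) :=
          fun h => absurd (hTmin ⟨by omega, h⟩) (by omega)
        have h3 : erasedInfo l E (b * l + 1) t ≤ erasedInfo l E (b * l + 1) (t + 1) :=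
          erasedInfo_mono (Nat.le_succ t)
        rw [receivedCoded_succ (by omega)] at h2 ⊢
        split_ifs at h2 ⊢ <;> omega
    have hlT : l ∣ T := by
      by_contra hlT
      obtain ⟨t, rfl⟩ : ∃ t, T = t + 1 := ⟨T - 1, by omega⟩
      have h1 := hlt t (by omega) (by omega)
      have h3 : erasedInfo l E (b * l + 1) t ≤ erasedInfo l E (b * l + 1) (t + 1) :=
        erasedInfo_mono (Nat.le_succ t)
      rw [receivedCoded_succ (by omega), if_neg (fun h => hlT h.1)] at hT
      omega
    obtain ⟨c, rfl⟩ := hlT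
    have hbc : b < c := by
      by_contra! h
      have := Nat.mul_le_mul_left l h
      rw [mul_comm l b] at this
      omega
    obtain ⟨n, rfl⟩ : ∃ n, c = b + n + 1 := ⟨c - b - 1, by omega⟩
    rw [mul_comm l] at hT hlt
    refine ⟨n, mul_comm _ _, fun i hi => ?_, ?_⟩
    · have h1 := hlt ((b + i + 1) * l) ?_ (Nat.mul_lt_mul_of_pos_right (by omega) hl)
      · have := hbal i
        omega
      · have := Nat.mul_le_mul_right l (show b + 1 ≤ b + i + 1 by omega)
        rw [add_mul, one_mul] at this
        omega
    · have := hbal n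
      omega
  · rintro ⟨n, rfl, hn⟩
    refine ⟨⟨?_, ?_⟩, ?_⟩
    · have := Nat.mul_le_mul_right l (show b + 1 ≤ b + n + 1 by omega)
      rw [add_mul, one_mul] at this
      omega
    · have := hbal n
      have := hn.2
      omega
    · rintro t ⟨hpt, ht⟩
      by_contra! htT
      obtain ⟨c, r, hr, rfl⟩ : ∃ c r, r < l ∧ t = c * l + r :=
        ⟨t / l, t % l, Nat.mod_lt _ hl, (Nat.div_add_mod' t l).symm⟩
      have hcn : c < b + n + 1 := by
        by_contra! h
        have := Nat.mul_le_mul_right l h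
        omega
      have hbc : b ≤ c := by
        by_contra! h
        have := Nat.mul_le_mul_right l (show c + 1 ≤ b by omega)
        rw [add_mul, one_mul] at this
        omega
      rw [receivedCoded_add_eq (by have := Nat.mul_le_mul_right l hbc; omega) hr] at ht
      have hmono : erasedInfo l E (b * l + 1) (c * l) ≤ erasedInfo l E (b * l + 1) (c * l + r) :=
        erasedInfo_mono (Nat.le_add_right _ _)
      rcases hbc.eq_or_lt with rfl | hbc
      · have := hR0 0 hl
        have := hDp _ hpt.le
        simp only [add_zero] at *
        omega
      · obtain ⟨i, rfl⟩ : ∃ i, c = b + i + 1 := ⟨c - b - 1, by omega⟩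
        have := hbal i
        have := hn.1 i (by omega)
        omega

theorem periodValue_of_isBusy {l : ℕ} {E : Set ℕ} {τ : ℕ} (h : IsBusy l E τ) :
    periodValue l E τ = (periodEnd l E τ).map (fun T => (T - τ) / l) :=
  if_pos h

theorem periodValue_of_not_isBusy {l : ℕ} {E : Set ℕ} {τ : ℕ} (h : ¬ IsBusy l E τ) :
    periodValue l E τ = 0 :=
  if_neg h

theorem periodValue_eq_zero_iff {l : ℕ} (hl : 1 ≤ l) {E : Set ℕ} {b : ℕ} :
    periodValue l E (b * l) = 0 ↔ erasures E (b * l) (l - 1) = 0 := by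
  rw [← not_iff_not, ← Ne, ← Ne, ← Nat.pos_iff_ne_zero, ← isBusy_iff hl]
  by_cases hb : IsBusy l E (b * l)
  · simp only [hb, iff_true, periodValue_of_isBusy hb]
    intro h
    cases hT : periodEnd l E (b * l) with
    | top =>
      rw [hT, ENat.map_top] at h
      exact ENat.top_ne_zero h
    | coe T =>
      obtain ⟨n, rfl, -⟩ := (periodEnd_eq_coe_iff hl hb).1 hT
      rw [hT, ENat.map_natCast, show (b + n + 1) * l - b * l = (n + 1) * l by
        rw [← Nat.sub_mul]; congr 1; omega, Nat.mul_div_cancel _ hl] at h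
      exact Nat.succ_ne_zero n (WithTop.coe_eq_zero.1 h)
  · simp [periodValue_of_not_isBusy hb, hb]

theorem periodValue_eq_succ_iff_periodEnd {l : ℕ} (hl : 1 ≤ l) {E : Set ℕ} {b s : ℕ} :
    periodValue l E (b * l) = ((s + 1 : ℕ) : ℕ∞) ↔
      IsBusy l E (b * l) ∧ periodEnd l E (b * l) = (((b + s + 1) * l : ℕ) : ℕ∞) := by
  by_cases hb : IsBusy l E (b * l)
  · simp only [hb, true_and, periodValue_of_isBusy hb]
    cases hT : periodEnd l E (b * l) with
    | top =>
      rw [ENat.map_top]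
      exact iff_of_false (ENat.natCast_ne_top _).symm (ENat.natCast_ne_top _).symm
    | coe T =>
      obtain ⟨n, rfl, -⟩ := (periodEnd_eq_coe_iff hl hb).1 hT
      rw [ENat.map_natCast, show (b + n + 1) * l - b * l = (n + 1) * l by
        rw [← Nat.sub_mul]; congr 1; omega, Nat.mul_div_cancel _ hl, Nat.cast_inj (R := ℕ∞),
        Nat.mul_left_inj (by omega)]
      refine WithTop.coe_inj.trans ?_
      omega
  · simp only [hb, false_and, iff_false, periodValue_of_not_isBusy hb]
    exact_mod_cast (Nat.succ_ne_zero s).symm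

theorem periodValue_eq_succ_iff {l : ℕ} (hl : 1 ≤ l) {E : Set ℕ} {b s : ℕ} :
    periodValue l E (b * l) = ((s + 1 : ℕ) : ℕ∞) ↔
      0 < erasures E (b * l) (l - 1) ∧ Hits l E s (b + 1) (erasures E (b * l) l - 1) := by
  rw [periodValue_eq_succ_iff_periodEnd hl, ← isBusy_iff hl]
  refine and_congr_right fun hb => ?_
  rw [periodEnd_eq_coe_iff hl hb]
  constructor
  · rintro ⟨n, h, hn⟩
    rw [Nat.mul_left_inj (by omega)] at h
    obtain rfl : s = n := by omega
    exact hn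
  · exact fun h => ⟨s, rfl, h⟩

theorem periodEnd_eq_top_iff {l : ℕ} {E : Set ℕ} {τ : ℕ} :
    periodEnd l E τ = ⊤ ↔ periodValue l E τ = ⊤ := by
  by_cases hb : IsBusy l E τ
  · rw [periodValue_of_isBusy hb]
    exact ENat.map_eq_top_iff.symm
  · rw [periodValue_of_not_isBusy hb, periodEnd, if_neg hb]
    exact iff_of_false (ENat.natCast_ne_top _) ENat.top_ne_zero.symm

/-- An idle period takes one block and a period of busy time `s > 0` takes `s` blocks. -/
theorem periodEnd_eq_coe_mul_iff {l : ℕ} (hl : 1 ≤ l) {E : Set ℕ} {b c : ℕ} :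
    periodEnd l E (b * l) = ((c * l : ℕ) : ℕ∞) ↔
      (c = b + 1 ∧ periodValue l E (b * l) = 0) ∨
        ∃ s, c = b + s + 1 ∧ periodValue l E (b * l) = ((s + 1 : ℕ) : ℕ∞) := by
  simp only [periodValue_eq_succ_iff_periodEnd hl, periodValue_eq_zero_iff hl]
  by_cases hb : IsBusy l E (b * l)
  · have h0 : erasures E (b * l) (l - 1) ≠ 0 := ((isBusy_iff hl).1 hb).ne'
    simp only [hb, h0, and_false, false_or, true_and]
    constructor
    · intro h
      obtain ⟨n, hn, -⟩ := (periodEnd_eq_coe_iff hl hb).1 h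
      rw [Nat.mul_left_inj (by omega)] at hn
      exact ⟨n, hn, hn ▸ h⟩
    · rintro ⟨s, rfl, h⟩
      exact h
  · have h0 : erasures E (b * l) (l - 1) = 0 := by
      rw [isBusy_iff hl] at hb
      omega
    simp only [periodEnd, hb, h0, if_false, false_and, and_false, exists_false, or_false, and_true]
    rw [Nat.cast_inj, show b * l + l = (b + 1) * l by ring, Nat.mul_left_inj (by omega), eq_comm]

/-- Every period starts at a block boundary. -/
theorem exists_periodStart_eq {l : ℕ} (hl : 1 ≤ l) {E : Set ℕ} {j : ℕ}
    (h : periodStart l E j ≠ ⊤) : ∃ b : ℕ, periodStart l E j = ((b * l : ℕ) : ℕ∞) := by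
  induction j with
  | zero => exact ⟨0, by simp [periodStart]⟩
  | succ j ih =>
    rw [periodStart] at h ⊢
    split_ifs at h ⊢ with h0
    · exact absurd rfl h
    obtain ⟨b, hb⟩ := ih h0
    rw [hb, ENat.toNat_natCast] at h ⊢
    by_cases hbusy : IsBusy l E (b * l)
    · cases hT : periodEnd l E (b * l) with
      | top => exact absurd hT h
      | coe T =>
        obtain ⟨n, rfl, -⟩ := (periodEnd_eq_coe_iff hl hbusy).1 hT
        exact ⟨_, rfl⟩
    · exact ⟨b + 1, by rw [periodEnd, if_neg hbusy, add_mul, one_mul]⟩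

theorem periodStart_succ_eq_iff {l : ℕ} (hl : 1 ≤ l) {E : Set ℕ} {j c : ℕ} :
    periodStart l E (j + 1) = ((c * l : ℕ) : ℕ∞) ↔
      ∃ b : ℕ, periodStart l E j = ((b * l : ℕ) : ℕ∞) ∧
        periodEnd l E (b * l) = ((c * l : ℕ) : ℕ∞) := by
  rw [periodStart]
  by_cases h : periodStart l E j = ⊤
  · rw [if_pos h, h]
    refine iff_of_false (ENat.natCast_ne_top _).symm ?_
    rintro ⟨b, hb, -⟩
    exact ENat.natCast_ne_top _ hb.symm
  · rw [if_neg h]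
    obtain ⟨b, hb⟩ := exists_periodStart_eq hl h
    rw [hb, ENat.toNat_natCast]
    constructor
    · exact fun h => ⟨b, rfl, h⟩
    · rintro ⟨b', h1, h2⟩
      rwa [Nat.cast_inj.1 h1]

theorem busyTime_eq_coe_iff {l : ℕ} (hl : 1 ≤ l) {E : Set ℕ} {j s : ℕ} :
    busyTime l E j = (s : ℕ∞) ↔
      ∃ b : ℕ, periodStart l E j = ((b * l : ℕ) : ℕ∞) ∧ periodValue l E (b * l) = (s : ℕ∞) := by
  rw [busyTime]
  by_cases h : periodStart l E j = ⊤
  · rw [if_pos h, h]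
    refine iff_of_false (ENat.natCast_ne_top _).symm ?_
    rintro ⟨b, hb, -⟩
    exact ENat.natCast_ne_top _ hb.symm
  · rw [if_neg h]
    obtain ⟨b, hb⟩ := exists_periodStart_eq hl h
    rw [hb, ENat.toNat_natCast]
    constructor
    · exact fun h => ⟨b, rfl, h⟩
    · rintro ⟨b', h1, h2⟩
      rwa [Nat.cast_inj.1 h1]

theorem periodStart_succ_eq_top_iff {l : ℕ} {E : Set ℕ} {j : ℕ} :
    periodStart l E (j + 1) = ⊤ ↔ busyTime l E j = ⊤ := by
  rw [periodStart, busyTime]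
  split_ifs
  · simp
  · exact periodEnd_eq_top_iff

/-! ### The binomial law and the ballot-type formula for the hitting time -/

/-- The binomial probability of `j` erasures among `m` slots. -/
noncomputable def binomPmf (ε : ℝ) (m j : ℕ) : ℝ :=
  m.choose j * ε ^ j * (1 - ε) ^ (m - j)

/-- The probability that the walk with steps `Z - 1`, where `Z` is binomial with parameters `l` and
`ε`, takes exactly `n` steps to reach `0` from `k`, defined by conditioning on the first step. -/
noncomputable def hitProb (l : ℕ) (ε : ℝ) : ℕ → ℕ → ℝ
  | 0, k => if k = 0 then 1 else 0
  | _ + 1, 0 => 0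
  | n + 1, k + 1 => ∑ j ∈ Finset.range (l + 1), binomPmf ε l j * hitProb l ε n (k + j)

/-- The probability that the first block has an erased slot and that `0` is reached exactly `s`
blocks later. -/
noncomputable def excursionProb (l : ℕ) (ε : ℝ) (s : ℕ) : ℝ :=
  ∑ j ∈ Finset.range l, binomPmf ε l (j + 1) * hitProb l ε s j

theorem binomPmf_nonneg {ε : ℝ} (h0 : 0 ≤ ε) (h1 : ε ≤ 1) (m j : ℕ) : 0 ≤ binomPmf ε m j := by
  have := sub_nonneg.2 h1
  unfold binomPmf
  positivity

theorem binomPmf_eq_zero_of_lt {ε : ℝ} {m j : ℕ} (h : m < j) : binomPmf ε m j = 0 := by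
  simp [binomPmf, Nat.choose_eq_zero_of_lt h]

theorem binomPmf_zero_right (ε : ℝ) (m : ℕ) : binomPmf ε m 0 = (1 - ε) ^ m := by
  simp [binomPmf]

theorem binomPmf_eq_eval (ε : ℝ) (m j : ℕ) :
    binomPmf ε m j = (bernsteinPolynomial ℝ m j).eval ε := by
  simp [binomPmf, bernsteinPolynomial]

theorem binomPmf_succ_succ (ε : ℝ) (m j : ℕ) :
    binomPmf ε (m + 1) (j + 1) = ε * binomPmf ε m j + (1 - ε) * binomPmf ε m (j + 1) := by
  simp only [binomPmf, Nat.choose_succ_succ, Nat.cast_add, Nat.add_sub_add_right]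
  rcases lt_or_ge m (j + 1) with h | h
  · rw [Nat.choose_eq_zero_of_lt h]
    simp only [Nat.cast_zero]
    ring
  · obtain ⟨d, rfl⟩ := Nat.exists_eq_add_of_le h
    rw [show j + 1 + d - j = d + 1 by omega, show j + 1 + d - (j + 1) = d by omega]
    ring

theorem sum_binomPmf (ε : ℝ) (m : ℕ) :
    ∑ j ∈ Finset.range (m + 1), binomPmf ε m j = 1 := by
  simpa [binomPmf_eq_eval, Polynomial.eval_finsetSum] using
    congrArg (Polynomial.eval ε) (bernsteinPolynomial.sum ℝ m)

theorem sum_binomPmf_mul (ε : ℝ) (m : ℕ) :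
    ∑ j ∈ Finset.range (m + 1), binomPmf ε m j * j = m * ε := by
  have := congrArg (Polynomial.eval ε) (bernsteinPolynomial.sum_smul ℝ m)
  simpa [binomPmf_eq_eval, Polynomial.eval_finsetSum, mul_comm] using this

theorem sum_binomPmf_mul_sq (ε : ℝ) (m : ℕ) :
    ∑ j ∈ Finset.range (m + 1), binomPmf ε m j * (j : ℝ) ^ 2 =
      m * (m - 1) * ε ^ 2 + m * ε := by
  have h2 : ∑ j ∈ Finset.range (m + 1), binomPmf ε m j * ((j : ℝ) * (j - 1)) =
      m * (m - 1) * ε ^ 2 := by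
    have hc : ∀ n : ℕ, (n : ℝ) * ((n - 1 : ℕ) : ℝ) = n * (n - 1) := by
      rintro (_ | n) <;> simp
    have := congrArg (Polynomial.eval ε) (bernsteinPolynomial.sum_mul_smul ℝ m)
    simpa [binomPmf_eq_eval, Polynomial.eval_finsetSum, mul_comm (Polynomial.eval _ _), hc]
      using this
  rw [← h2, ← sum_binomPmf_mul, ← Finset.sum_add_distrib]
  exact Finset.sum_congr rfl fun j _ => by ring

theorem sum_binomPmf_mul_pow (ε x : ℝ) (m : ℕ) :
    ∑ j ∈ Finset.range (m + 1), binomPmf ε m j * x ^ j = (ε * x + (1 - ε)) ^ m := by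
  rw [add_pow]
  exact Finset.sum_congr rfl fun j _ => by rw [binomPmf, mul_pow]; ring

theorem binomPmf_mul_binomPmf (ε : ℝ) (a b i j : ℕ) :
    binomPmf ε a i * binomPmf ε b j =
      ((a.choose i * b.choose j : ℕ) : ℝ) * (ε ^ (i + j) * (1 - ε) ^ (a + b - (i + j))) := by
  rcases lt_or_ge a i with h | h
  · simp [binomPmf, Nat.choose_eq_zero_of_lt h]
  rcases lt_or_ge b j with h' | h'
  · simp [binomPmf, Nat.choose_eq_zero_of_lt h']
  rw [show a + b - (i + j) = (a - i) + (b - j) by omega, binomPmf, binomPmf, pow_add, pow_add]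
  push_cast
  ring

/-- The sum of independent binomial variables is binomial. -/
theorem sum_antidiagonal_binomPmf (ε : ℝ) (a b r : ℕ) :
    ∑ p ∈ antidiagonal r, binomPmf ε a p.1 * binomPmf ε b p.2 = binomPmf ε (a + b) r := by
  rw [binomPmf, Nat.add_choose_eq, Nat.cast_sum, mul_assoc, Finset.sum_mul]
  refine Finset.sum_congr rfl fun p hp => ?_
  rw [binomPmf_mul_binomPmf, mem_antidiagonal.1 hp]

theorem add_mul_sum_antidiagonal_mul_choose (a b r : ℕ) :
    (a + b) * ∑ p ∈ antidiagonal r, p.1 * (a.choose p.1 * b.choose p.2) =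
      a * (r * (a + b).choose r) := by
  cases r with
  | zero => simp
  | succ r =>
    cases a with
    | zero =>
      rw [zero_mul]
      refine Nat.mul_eq_zero.2 (Or.inr (Finset.sum_eq_zero fun p _ => ?_))
      rcases p.1 with _ | i <;> simp
    | succ a =>
      have h1 : ∑ p ∈ antidiagonal (r + 1),
          p.1 * ((a + 1).choose p.1 * b.choose p.2) = (a + 1) * (a + b).choose r := by
        rw [Finset.Nat.sum_antidiagonal_succ, Nat.add_choose_eq a b, Finset.mul_sum, zero_mul, zero_add]
        refine Finset.sum_congr rfl fun p _ => ?_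
        rw [← mul_assoc, ← mul_assoc, Nat.add_one_mul_choose_eq a p.1, mul_comm (p.1 + 1)]
      rw [h1, show a + 1 + b = a + b + 1 by ring, mul_comm (r + 1), ← Nat.add_one_mul_choose_eq]
      ring

/-- Given that `r` of `a + b` slots are erased, the mean number of erasures among the first `a` of
them is `r * a / (a + b)`. -/
theorem add_mul_sum_antidiagonal_mul_binomPmf (ε : ℝ) (a b r : ℕ) :
    ((a : ℝ) + b) * ∑ p ∈ antidiagonal r, p.1 * (binomPmf ε a p.1 * binomPmf ε b p.2) =
      a * (r * binomPmf ε (a + b) r) := by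
  have h := congrArg (Nat.cast (R := ℝ)) (add_mul_sum_antidiagonal_mul_choose a b r)
  have hs : ∑ p ∈ antidiagonal r, (p.1 : ℝ) * (binomPmf ε a p.1 * binomPmf ε b p.2) =
      (∑ p ∈ antidiagonal r, ((p.1 * (a.choose p.1 * b.choose p.2) : ℕ) : ℝ)) *
        (ε ^ r * (1 - ε) ^ (a + b - r)) := by
    rw [Finset.sum_mul]
    refine Finset.sum_congr rfl fun p hp => ?_
    rw [binomPmf_mul_binomPmf, mem_antidiagonal.1 hp]
    push_cast
    ring
  rw [hs, binomPmf]
  push_cast at h ⊢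
  linear_combination (ε ^ r * (1 - ε) ^ (a + b - r)) * h

theorem sum_antidiagonal_mul_binomPmf_block {l : ℕ} (hl : 1 ≤ l) (ε : ℝ) (n r : ℕ) :
    ((n : ℝ) + 1) * ∑ p ∈ antidiagonal r,
        p.1 * (binomPmf ε l p.1 * binomPmf ε (n * l) p.2) =
      r * binomPmf ε ((n + 1) * l) r := by
  have h := add_mul_sum_antidiagonal_mul_binomPmf ε l (n * l) r
  have hl' : (l : ℝ) ≠ 0 := by positivity
  rw [show l + n * l = (n + 1) * l by ring] at h
  refine mul_left_cancel₀ hl' ?_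
  rw [← h]
  push_cast
  ring

theorem sum_range_binomPmf_mul_eq_sum_antidiagonal (ε : ℝ) (m r : ℕ) (f : ℕ → ℝ)
    (hf : ∀ j, r < j → f j = 0) :
    ∑ j ∈ Finset.range (m + 1), binomPmf ε m j * f j =
      ∑ p ∈ antidiagonal r, binomPmf ε m p.1 * f p.1 := by
  rw [Finset.Nat.sum_antidiagonal_eq_sum_range_succ_mk]
  have h1 : ∑ j ∈ Finset.range (m + 1), binomPmf ε m j * f j =
      ∑ j ∈ Finset.range (m + r + 1), binomPmf ε m j * f j := by
    refine Finset.sum_subset (Finset.range_mono (by omega)) fun j _ hj => ?_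
    rw [binomPmf_eq_zero_of_lt (by simpa using hj), zero_mul]
  have h2 : ∑ j ∈ Finset.range (r + 1), binomPmf ε m j * f j =
      ∑ j ∈ Finset.range (m + r + 1), binomPmf ε m j * f j := by
    refine Finset.sum_subset (Finset.range_mono (by omega)) fun j _ hj => ?_
    rw [hf j (by simpa using hj), mul_zero]
  rw [h1, ← h2]

theorem hitProb_nonneg {l : ℕ} {ε : ℝ} (h0 : 0 ≤ ε) (h1 : ε ≤ 1) (n k : ℕ) :
    0 ≤ hitProb l ε n k := by
  induction n generalizing k with
  | zero => rw [hitProb]; split_ifs <;> norm_num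
  | succ n ih =>
    cases k with
    | zero => rw [hitProb]
    | succ k =>
      rw [hitProb]
      exact Finset.sum_nonneg fun j _ => mul_nonneg (binomPmf_nonneg h0 h1 _ _) (ih _)

theorem hitProb_eq_zero_of_lt {l : ℕ} {ε : ℝ} {n k : ℕ} (h : n < k) : hitProb l ε n k = 0 := by
  induction n generalizing k with
  | zero => rw [hitProb, if_neg (by omega)]
  | succ n ih =>
    obtain ⟨k, rfl⟩ : ∃ k', k = k' + 1 := ⟨k - 1, by omega⟩
    rw [hitProb]
    exact Finset.sum_eq_zero fun j _ => by rw [ih (by omega), mul_zero]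

/-- Kemperman's formula: the walk reaches `0` from `k` for the first time after `n = k + r` steps
with probability `k / n` times the probability that it is at `0` after `n` steps. -/
theorem mul_hitProb {l : ℕ} (hl : 1 ≤ l) (ε : ℝ) (k r : ℕ) :
    ((k : ℝ) + r) * hitProb l ε (k + r) k = k * binomPmf ε ((k + r) * l) r := by
  obtain ⟨n, hn⟩ : ∃ n, n = k + r := ⟨_, rfl⟩
  induction n generalizing k r with
  | zero =>
    obtain ⟨rfl, rfl⟩ : k = 0 ∧ r = 0 := by omega
    simp
  | succ n ih =>
    cases k with
    | zero =>
      obtain ⟨r, rfl⟩ : ∃ r', r = r' + 1 := ⟨r - 1, by omega⟩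
      rw [zero_add, hitProb]
      simp
    | succ k =>
      obtain rfl : n = k + r := by omega
      rw [show k + 1 + r = (k + r) + 1 by ring, hitProb,
        sum_range_binomPmf_mul_eq_sum_antidiagonal ε l r _
          (fun j hj => hitProb_eq_zero_of_lt (by omega))]
      rcases Nat.eq_zero_or_pos (k + r) with h0 | h0
      · obtain ⟨rfl, rfl⟩ : k = 0 ∧ r = 0 := by omega
        simp [hitProb]
      have hpos : ((k : ℝ) + r) ≠ 0 := by exact_mod_cast h0.ne'
      have h1 : ((k : ℝ) + r) * ∑ p ∈ antidiagonal r,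
          binomPmf ε l p.1 * hitProb l ε (k + r) (k + p.1) =
          k * binomPmf ε ((k + r + 1) * l) r +
            ∑ p ∈ antidiagonal r,
              p.1 * (binomPmf ε l p.1 * binomPmf ε ((k + r) * l) p.2) := by
        rw [show (k + r + 1) * l = l + (k + r) * l by ring, ← sum_antidiagonal_binomPmf,
          Finset.mul_sum, Finset.mul_sum, ← Finset.sum_add_distrib]
        refine Finset.sum_congr rfl fun p hp => ?_
        obtain rfl := mem_antidiagonal.1 hp
        have := ih (k + p.1) p.2 (by omega)
        rw [add_assoc k] at this
        push_cast at this ⊢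
        linear_combination (binomPmf ε l p.1) * this
      have h2 := sum_antidiagonal_mul_binomPmf_block hl ε (k + r) r
      refine mul_left_cancel₀ hpos ?_
      push_cast at h2 ⊢
      linear_combination ((k : ℝ) + r + 1) * h1 + h2

theorem excursionProb_zero {l : ℕ} (hl : 1 ≤ l) (ε : ℝ) :
    excursionProb l ε 0 = l * ε * (1 - ε) ^ (l - 1) := by
  rw [excursionProb, Finset.sum_eq_single_of_mem 0 (Finset.mem_range.2 hl)]
  · simp [hitProb, binomPmf]
  · intro j _ hj
    simp [hitProb, hj]

theorem mul_excursionProb {l : ℕ} (hl : 1 ≤ l) (ε : ℝ) (s : ℕ) :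
    (s : ℝ) * excursionProb l ε s = (1 - ε) ^ l * binomPmf ε (s * l) (s + 1) := by
  have h0 : excursionProb l ε s =
      ∑ p ∈ antidiagonal s, binomPmf ε l (p.1 + 1) * hitProb l ε s p.1 := by
    have := sum_range_binomPmf_mul_eq_sum_antidiagonal ε l (s + 1)
      (fun j => if j = 0 then 0 else hitProb l ε s (j - 1))
      (fun j hj => by rw [if_neg (by omega), hitProb_eq_zero_of_lt (by omega)])
    rw [Finset.sum_range_succ', Finset.Nat.sum_antidiagonal_succ] at this
    simpa [excursionProb] using this
  have h1 := sum_antidiagonal_mul_binomPmf_block hl ε s (s + 1)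
  have h2 : binomPmf ε ((s + 1) * l) (s + 1) =
      ∑ p ∈ antidiagonal (s + 1), binomPmf ε l p.1 * binomPmf ε (s * l) p.2 := by
    rw [sum_antidiagonal_binomPmf, show (s + 1) * l = l + s * l by ring]
  have h3 : (s : ℝ) * excursionProb l ε s = ∑ p ∈ antidiagonal s,
      p.1 * (binomPmf ε l (p.1 + 1) * binomPmf ε (s * l) p.2) := by
    rw [h0, Finset.mul_sum]
    refine Finset.sum_congr rfl fun p hp => ?_
    obtain rfl := mem_antidiagonal.1 hp
    have := mul_hitProb hl ε p.1 p.2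
    push_cast at this ⊢
    linear_combination (binomPmf ε l (p.1 + 1)) * this
  rw [h2] at h1
  push_cast at h1
  have h4 := mul_left_cancel₀ (by positivity : ((s : ℝ) + 1) ≠ 0) h1
  rw [Finset.Nat.sum_antidiagonal_succ, Finset.Nat.sum_antidiagonal_succ, binomPmf_zero_right] at h4
  rw [h3]
  have h5 : ∑ p ∈ antidiagonal s,
        ((p.1 + 1 : ℕ) : ℝ) * (binomPmf ε l (p.1 + 1) * binomPmf ε (s * l) p.2) =
      ∑ p ∈ antidiagonal s, p.1 * (binomPmf ε l (p.1 + 1) * binomPmf ε (s * l) p.2) +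
        ∑ p ∈ antidiagonal s, binomPmf ε l (p.1 + 1) * binomPmf ε (s * l) p.2 := by
    rw [← Finset.sum_add_distrib]
    exact Finset.sum_congr rfl fun p _ => by push_cast; ring
  simp only [h5] at h4
  push_cast at h4
  linear_combination h4

/-- The busy time exceeds the excursion length by one block, except that a first block whose only
erased slot is the coded one makes an excursion of length `0` but an idle period. -/
theorem busyPmf_succ {l : ℕ} (hl : 1 ≤ l) (ε : ℝ) (s : ℕ) :
    busyPmf l ε (s + 1) =
      excursionProb l ε s - if s = 0 then ε * (1 - ε) ^ (l - 1) else 0 := by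
  rcases Nat.eq_zero_or_pos s with rfl | hs
  · rw [busyPmf, if_neg (by omega), if_pos rfl, excursionProb_zero hl, if_pos rfl]
    ring
  rw [busyPmf, if_neg (by omega), if_neg (by omega), if_neg hs.ne', sub_zero]
  have hs' : (s : ℝ) ≠ 0 := by positivity
  refine mul_left_cancel₀ hs' ?_
  rw [mul_excursionProb hl, binomPmf, Nat.add_sub_cancel]
  have hc : ((s * l).choose (s + 1) : ℝ) * (s + 1) = (s * l).choose s * (s * (l - 1)) := by
    have := congrArg (Nat.cast (R := ℝ)) (Nat.choose_succ_right_eq (s * l) s)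
    have hle : s ≤ s * l := Nat.le_mul_of_pos_right s hl
    push_cast [Nat.cast_sub hle] at this
    rw [this]
    ring
  have hs1 : (s : ℝ) + 1 ≠ 0 := by positivity
  have hexp : (1 - ε) ^ ((s + 1) * (l - 1)) * ((s * l).choose (s + 1) : ℝ) =
      (1 - ε) ^ l * (1 - ε) ^ (s * l - (s + 1)) * (s * l).choose (s + 1) := by
    rcases lt_or_ge (s * l) (s + 1) with h | h
    · simp [Nat.choose_eq_zero_of_lt h]
    · rw [← pow_add]
      congr 2
      obtain ⟨l, rfl⟩ : ∃ l', l = l' + 1 := ⟨l - 1, by omega⟩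
      have h1 : (s + 1) * (l + 1) = (s + 1) * l + (s + 1) := by ring
      have h2 : (s + 1) * (l + 1) = s * (l + 1) + (l + 1) := by ring
      rw [Nat.add_sub_cancel]
      omega
  push_cast
  field_simp
  field_simp at hexp
  linear_combination (-ε ^ (s + 1) * (1 - ε) ^ ((s + 1) * (l - 1))) * hc +
    (ε ^ (s + 1) * (s + 1)) * hexp

/-! ### Total mass and moments -/

/-- As the walk goes down by at most one per step, the way from `k + k'` to `0` splits at the first
visit to `k'`. -/
theorem hitProb_add (l : ℕ) (ε : ℝ) (n k k' : ℕ) :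
    hitProb l ε n (k + k') =
      ∑ p ∈ antidiagonal n, hitProb l ε p.1 k * hitProb l ε p.2 k' := by
  induction n generalizing k with
  | zero =>
    rcases Nat.eq_zero_or_pos k with rfl | hk
    · simp [hitProb]
    · simp [hitProb, hk.ne']
  | succ n ih =>
    rw [Finset.Nat.sum_antidiagonal_succ]
    cases k with
    | zero => simp [hitProb]
    | succ k =>
      rw [show k + 1 + k' = (k + k') + 1 by ring]
      simp only [hitProb, Nat.add_eq_zero_iff, one_ne_zero, and_false, if_false, zero_mul, zero_add,
        Finset.sum_mul]
      rw [Finset.sum_comm]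
      refine Finset.sum_congr rfl fun j _ => ?_
      rw [show k + k' + j = k + j + k' by ring, ih, Finset.mul_sum]
      exact Finset.sum_congr rfl fun p _ => by ring

theorem sum_range_succ_mul_hitProb_succ (l : ℕ) (ε : ℝ) (u : ℕ → ℝ) (N k : ℕ) :
    ∑ n ∈ Finset.range (N + 1), u n * hitProb l ε n (k + 1) =
      ∑ j ∈ Finset.range (l + 1), binomPmf ε l j *
        ∑ n ∈ Finset.range N, u (n + 1) * hitProb l ε n (k + j) := by
  rw [Finset.sum_range_succ']
  simp only [hitProb, Nat.add_eq_zero_iff, one_ne_zero, and_false, if_false, mul_zero, add_zero,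
    Finset.mul_sum]
  rw [Finset.sum_comm]
  exact Finset.sum_congr rfl fun j _ => Finset.sum_congr rfl fun n _ => by ring

theorem sum_range_succ_mul_hitProb_zero (l : ℕ) (ε : ℝ) (u : ℕ → ℝ) (N : ℕ) :
    ∑ n ∈ Finset.range (N + 1), u n * hitProb l ε n 0 = u 0 := by
  rw [Finset.sum_range_succ']
  simp [hitProb]

/-- A bound `g` on the `u`-moments of the hitting times follows from a bound `c` on the moments of the
increments of `u`, if `g` at `k + 1` is at least the mean of `g + c` one step later. -/
theorem sum_range_mul_hitProb_le {l : ℕ} {ε : ℝ} (h0 : 0 ≤ ε) (h1 : ε ≤ 1) (u g : ℕ → ℝ)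
    (hu : u 0 ≤ g 0) (hg : ∀ k, 0 ≤ g k) (c : ℕ → ℝ)
    (hc : ∀ N k, ∑ n ∈ Finset.range N, (u (n + 1) - u n) * hitProb l ε n k ≤ c k)
    (hstep : ∀ k, ∑ j ∈ Finset.range (l + 1), binomPmf ε l j * (g (k + j) + c (k + j)) ≤ g (k + 1))
    (N k : ℕ) : ∑ n ∈ Finset.range N, u n * hitProb l ε n k ≤ g k := by
  induction N generalizing k with
  | zero => simpa using hg k
  | succ N ih =>
    cases k with
    | zero => rwa [sum_range_succ_mul_hitProb_zero]
    | succ k =>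
      rw [sum_range_succ_mul_hitProb_succ]
      refine le_trans (Finset.sum_le_sum fun j _ => ?_) (hstep k)
      refine mul_le_mul_of_nonneg_left ?_ (binomPmf_nonneg h0 h1 _ _)
      refine le_trans (le_of_eq ?_) (add_le_add (ih (k + j)) (hc N (k + j)))
      rw [← Finset.sum_add_distrib]
      exact Finset.sum_congr rfl fun n _ => by ring

theorem sum_range_hitProb_le {l : ℕ} {ε : ℝ} (h0 : 0 ≤ ε) (h1 : ε ≤ 1) (N k : ℕ) :
    ∑ n ∈ Finset.range N, hitProb l ε n k ≤ 1 := by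
  have := sum_range_mul_hitProb_le h0 h1 (l := l) (fun _ => 1) (fun _ => 1) le_rfl (by simp)
    (fun _ => 0) (by simp) (fun k => by simp [sum_binomPmf]) N k
  simpa using this

theorem sum_binomPmf_mul_quadratic (ε α β γ : ℝ) (l : ℕ) :
    ∑ j ∈ Finset.range (l + 1), binomPmf ε l j * (α * (j : ℝ) ^ 2 + β * j + γ) =
      α * (l * (l - 1) * ε ^ 2 + l * ε) + β * (l * ε) + γ := by
  have h : α * (l * (l - 1) * ε ^ 2 + l * ε) + β * (l * ε) + γ =
      α * ∑ j ∈ Finset.range (l + 1), binomPmf ε l j * (j : ℝ) ^ 2 +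
        β * ∑ j ∈ Finset.range (l + 1), binomPmf ε l j * j +
          γ * ∑ j ∈ Finset.range (l + 1), binomPmf ε l j := by
    rw [sum_binomPmf_mul_sq, sum_binomPmf_mul, sum_binomPmf, mul_one]
  rw [h, Finset.mul_sum, Finset.mul_sum, Finset.mul_sum,
    ← Finset.sum_add_distrib, ← Finset.sum_add_distrib]
  exact Finset.sum_congr rfl fun j _ => by ring

theorem sum_range_id_mul_hitProb_le {l : ℕ} {ε : ℝ} (h0 : 0 ≤ ε) (h1 : ε ≤ 1)
    (hlt : (l : ℝ) * ε < 1) (N k : ℕ) :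
    ∑ n ∈ Finset.range N, (n : ℝ) * hitProb l ε n k ≤ k / (1 - l * ε) := by
  have hd : 0 < 1 - (l : ℝ) * ε := sub_pos.2 hlt
  refine sum_range_mul_hitProb_le h0 h1 (fun n : ℕ => (n : ℝ)) (fun k => (k : ℝ) / (1 - l * ε))
    (by simp) (fun k => by positivity) (fun _ => 1) (fun N k => ?_) (fun k => le_of_eq ?_) N k
  · simpa using sum_range_hitProb_le h0 h1 N k
  · have := sum_binomPmf_mul_quadratic ε 0 (1 / (1 - l * ε)) (k / (1 - l * ε) + 1) l
    rw [show ((k + 1 : ℕ) : ℝ) / (1 - l * ε) =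
      0 * (l * (l - 1) * ε ^ 2 + l * ε) + 1 / (1 - l * ε) * (l * ε) + (k / (1 - l * ε) + 1) by
        push_cast; field_simp; ring, ← this]
    refine Finset.sum_congr rfl fun j _ => ?_
    push_cast
    ring

theorem sum_range_sq_mul_hitProb_le {l : ℕ} {ε : ℝ} (hl : 1 ≤ l) (h0 : 0 ≤ ε) (h1 : ε ≤ 1)
    (hlt : (l : ℝ) * ε < 1) (k : ℕ) :
    ∃ C, ∀ N, ∑ n ∈ Finset.range N, (n : ℝ) ^ 2 * hitProb l ε n k ≤ C := by
  obtain ⟨d, hd⟩ : ∃ d, d = 1 - (l : ℝ) * ε := ⟨_, rfl⟩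
  obtain ⟨m, hm⟩ : ∃ m, m = (l : ℝ) * (l - 1) * ε ^ 2 + l * ε := ⟨_, rfl⟩
  have hl1 : (1 : ℝ) ≤ l := by exact_mod_cast hl
  have hd0 : 0 < d := hd ▸ sub_pos.2 hlt
  have hm0 : 0 ≤ m := by
    have := sub_nonneg.2 hl1
    rw [hm]
    positivity
  obtain ⟨β, hβ⟩ : ∃ β, β = (m / d ^ 2 + 2 / d) / d := ⟨_, rfl⟩
  have hβ0 : 0 ≤ β := hβ ▸ by positivity
  -- `k ^ 2 / d ^ 2` cancels the terms of the drift inequality that are linear in `k`, and `β`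
  -- absorbs the constant ones.
  refine ⟨_, fun N => sum_range_mul_hitProb_le h0 h1 (fun n : ℕ => (n : ℝ) ^ 2)
    (fun k => (k : ℝ) ^ 2 / d ^ 2 + β * k) (by simp) (fun k => by positivity)
    (fun k => 2 * (k / d) + 1) (fun N k => ?_) (fun k => ?_) N k⟩
  · have e1 := sum_range_id_mul_hitProb_le h0 h1 hlt N k
    have e2 := sum_range_hitProb_le h0 h1 (l := l) N k
    rw [← hd] at e1
    refine le_trans (le_of_eq ?_) (add_le_add (mul_le_mul_of_nonneg_left e1 zero_le_two) e2)
    rw [Finset.mul_sum, ← Finset.sum_add_distrib]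
    exact Finset.sum_congr rfl fun n _ => by push_cast; ring
  · have := sum_binomPmf_mul_quadratic ε (1 / d ^ 2) (2 * k / d ^ 2 + β + 2 / d)
      ((k : ℝ) ^ 2 / d ^ 2 + β * k + 2 * k / d + 1) l
    refine le_trans (le_of_eq (Eq.trans ?_ this)) ?_
    · refine Finset.sum_congr rfl fun j _ => ?_
      push_cast
      ring
    · rw [← hm, show (l : ℝ) * ε = 1 - d by rw [hd]; ring]
      have hβd : β * d = m / d ^ 2 + 2 / d := by rw [hβ]; field_simp
      have : ((k + 1 : ℕ) : ℝ) ^ 2 / d ^ 2 + β * (k + 1 : ℕ) -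
          (1 / d ^ 2 * m + (2 * k / d ^ 2 + β + 2 / d) * (1 - d) +
            ((k : ℝ) ^ 2 / d ^ 2 + β * k + 2 * k / d + 1)) =
          1 / d ^ 2 + 1 + (β * d - (m / d ^ 2 + 2 / d)) := by
        push_cast
        field_simp
        ring
      rw [hβd, sub_self, add_zero] at this
      have : 0 ≤ 1 / d ^ 2 + 1 := by positivity
      linarith

theorem summable_hitProb {l : ℕ} {ε : ℝ} (h0 : 0 ≤ ε) (h1 : ε ≤ 1) (k : ℕ) :
    Summable fun n => hitProb l ε n k :=
  summable_of_sum_range_le (fun n => hitProb_nonneg h0 h1 n k)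
    fun N => sum_range_hitProb_le h0 h1 N k

theorem summable_id_mul_hitProb {l : ℕ} {ε : ℝ} (h0 : 0 ≤ ε) (h1 : ε ≤ 1)
    (hlt : (l : ℝ) * ε < 1) (k : ℕ) : Summable fun n : ℕ => (n : ℝ) * hitProb l ε n k :=
  summable_of_sum_range_le (fun n => mul_nonneg n.cast_nonneg (hitProb_nonneg h0 h1 n k))
    fun N => sum_range_id_mul_hitProb_le h0 h1 hlt N k

theorem summable_sq_mul_hitProb {l : ℕ} {ε : ℝ} (hl : 1 ≤ l) (h0 : 0 ≤ ε) (h1 : ε ≤ 1)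
    (hlt : (l : ℝ) * ε < 1) (k : ℕ) : Summable fun n : ℕ => (n : ℝ) ^ 2 * hitProb l ε n k := by
  obtain ⟨C, hC⟩ := sum_range_sq_mul_hitProb_le hl h0 h1 hlt k
  exact summable_of_sum_range_le (fun n => mul_nonneg (sq_nonneg _) (hitProb_nonneg h0 h1 n k)) hC

theorem hasSum_antidiagonal_mul {f g : ℕ → ℝ} (hf : Summable f) (hg : Summable g) :
    HasSum (fun n => ∑ p ∈ antidiagonal n, f p.1 * g p.2)
      ((∑' n, f n) * ∑' n, g n) := by
  rw [tsum_mul_tsum_eq_tsum_sum_antidiagonal_of_summable_norm hf.norm hg.norm]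
  exact (summable_norm_sum_mul_antidiagonal_of_summable_norm hf.norm hg.norm).of_norm.hasSum

theorem hasSum_mul_hitProb_succ {l : ℕ} {ε : ℝ} {u : ℕ → ℝ} {U : ℕ → ℝ} {k : ℕ}
    (hU : ∀ j, HasSum (fun n => u (n + 1) * hitProb l ε n j) (U j)) :
    HasSum (fun n => u n * hitProb l ε n (k + 1))
      (∑ j ∈ Finset.range (l + 1), binomPmf ε l j * U (k + j)) := by
  rw [← hasSum_nat_add_iff' 1]
  simp only [Finset.range_one, Finset.sum_singleton, hitProb, Nat.add_eq_zero_iff, one_ne_zero,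
    and_false, if_false, mul_zero, sub_zero, Finset.mul_sum]
  refine hasSum_sum fun j _ => ?_
  simpa only [mul_left_comm] using (hU (k + j)).mul_left (binomPmf ε l j)

theorem tsum_hitProb_eq_pow {l : ℕ} {ε : ℝ} (h0 : 0 ≤ ε) (h1 : ε ≤ 1) (k : ℕ) :
    ∑' n, hitProb l ε n k = (∑' n, hitProb l ε n 1) ^ k := by
  induction k with
  | zero =>
    rw [pow_zero, tsum_eq_single 0]
    · simp [hitProb]
    · rintro (_ | n) hn
      · exact absurd rfl hn
      · rw [hitProb]
  | succ k ih =>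
    simp only [hitProb_add l ε _ k 1]
    rw [(hasSum_antidiagonal_mul (summable_hitProb h0 h1 k) (summable_hitProb h0 h1 1)).tsum_eq, ih,
      pow_succ]

/-- The hitting probability `q` of the level just below is a fixed point of the generating function
`(ε * x + (1 - ε)) ^ l`. -/
theorem tsum_hitProb_one_eq {l : ℕ} {ε : ℝ} (h0 : 0 ≤ ε) (h1 : ε ≤ 1) :
    ∑' n, hitProb l ε n 1 = (ε * (∑' n, hitProb l ε n 1) + (1 - ε)) ^ l := by
  have := hasSum_mul_hitProb_succ (l := l) (ε := ε) (u := fun _ => 1) (k := 0)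
    (fun j => by simpa using (summable_hitProb h0 h1 j).hasSum)
  simp only [one_mul, zero_add] at this
  rw [← sum_binomPmf_mul_pow]
  rw [this.tsum_eq]
  exact Finset.sum_congr rfl fun j _ => by rw [tsum_hitProb_eq_pow h0 h1 j, this.tsum_eq]

/-- The fixed point `q` is `1` up to capacity, since by Bernoulli's inequality the generating function
lies strictly above the diagonal on `[0, 1)`. -/
theorem hasSum_hitProb {l : ℕ} {ε : ℝ} (h0 : 0 ≤ ε) (h1 : ε ≤ 1)
    (hl : (l : ℝ) * ε < 1 ∨ 2 ≤ l ∧ (l : ℝ) * ε ≤ 1) (k : ℕ) :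
    HasSum (fun n => hitProb l ε n k) 1 := by
  obtain ⟨q, hq⟩ : ∃ q, q = ∑' n, hitProb l ε n 1 := ⟨_, rfl⟩
  have hfix : q = (1 + ε * (q - 1)) ^ l := by
    rw [show 1 + ε * (q - 1) = ε * q + (1 - ε) by ring, hq]
    exact tsum_hitProb_one_eq h0 h1
  have hq0 : 0 ≤ q := hq ▸ tsum_nonneg fun n => hitProb_nonneg h0 h1 n 1
  have hq1 : q ≤ 1 := hq ▸ (summable_hitProb h0 h1 1).tsum_le_of_sum_range_le
    fun N => sum_range_hitProb_le h0 h1 N 1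
  have hx : -1 ≤ ε * (q - 1) := by nlinarith
  have hq_one : q = 1 := by
    refine le_antisymm hq1 (not_lt.1 fun hlt => ?_)
    have hB := one_add_mul_le_pow (by linarith : -2 ≤ ε * (q - 1)) l
    rw [← hfix] at hB
    rcases hl with hl | ⟨hl2, hl⟩
    · nlinarith
    · have hε : ε ≠ 0 := by
        rintro rfl
        rw [zero_mul, add_zero, one_pow] at hfix
        exact hlt.ne hfix
      have hl2' : (1 : ℝ) < l := by exact_mod_cast hl2
      have := one_add_mul_self_lt_rpow_one_add hx (mul_ne_zero hε (by linarith)) hl2'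
      rw [Real.rpow_natCast, ← hfix] at this
      nlinarith
  have := (summable_hitProb (l := l) h0 h1 k).hasSum
  rwa [tsum_hitProb_eq_pow h0 h1, ← hq, hq_one, one_pow] at this

theorem hasSum_id_mul_hitProb {l : ℕ} {ε : ℝ} (h0 : 0 ≤ ε) (h1 : ε ≤ 1)
    (hlt : (l : ℝ) * ε < 1) (k : ℕ) :
    HasSum (fun n : ℕ => (n : ℝ) * hitProb l ε n k) (k / (1 - l * ε)) := by
  have hd : 1 - (l : ℝ) * ε ≠ 0 := (sub_pos.2 hlt).ne'
  have hA := fun k => hasSum_hitProb h0 h1 (Or.inl hlt) k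
  have hM := fun k => summable_id_mul_hitProb h0 h1 hlt k
  obtain ⟨m, hm⟩ : ∃ m : ℕ → ℝ, m = fun k => ∑' n : ℕ, (n : ℝ) * hitProb l ε n k := ⟨_, rfl⟩
  have hMs : ∀ k, HasSum (fun n : ℕ => (n : ℝ) * hitProb l ε n k) (m k) := fun k => by
    rw [hm]; exact (hM k).hasSum
  have hadd : ∀ k, m (k + 1) = m k + m 1 := by
    intro k
    have e1 := hasSum_antidiagonal_mul (hM k) (hA 1).summable
    have e2 := hasSum_antidiagonal_mul (hA k).summable (hM 1)
    rw [(hA 1).tsum_eq, (hMs k).tsum_eq, mul_one] at e1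
    rw [(hA k).tsum_eq, (hMs 1).tsum_eq, one_mul] at e2
    refine (hMs (k + 1)).unique ?_
    convert e1.add e2 using 1
    ext n
    rw [hitProb_add, Finset.mul_sum, ← Finset.sum_add_distrib]
    refine Finset.sum_congr rfl fun p hp => ?_
    obtain rfl := mem_antidiagonal.1 hp
    push_cast
    ring
  have hlin : ∀ k : ℕ, m k = k * m 1 := by
    intro k
    induction k with
    | zero =>
      have := hadd 0
      rw [zero_add] at this
      push_cast
      linarith
    | succ k ih => rw [hadd, ih]; push_cast; ring
  have hrec : m 1 = l * ε * m 1 + 1 := by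
    have := hasSum_mul_hitProb_succ (l := l) (ε := ε) (u := fun n : ℕ => (n : ℝ)) (k := 0)
      (U := fun j => m j + 1) (fun j => by
        convert (hMs j).add (hA j) using 1
        ext n
        push_cast
        ring)
    have h2 := sum_binomPmf_mul_quadratic ε 0 (m 1) 1 l
    rw [zero_mul, zero_add, mul_comm (m 1)] at h2
    rw [← h2]
    refine ((hMs 1).unique this).trans (Finset.sum_congr rfl fun j _ => ?_)
    rw [zero_add, hlin j]
    ring
  have h1' : m 1 = 1 / (1 - l * ε) := by
    rw [eq_div_iff hd]
    linarith
  have := hMs k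
  rwa [hlin, h1', mul_one_div] at this

theorem hasSum_sq_mul_hitProb {l : ℕ} {ε : ℝ} (hl : 1 ≤ l) (h0 : 0 ≤ ε) (h1 : ε ≤ 1)
    (hlt : (l : ℝ) * ε < 1) (k : ℕ) :
    HasSum (fun n : ℕ => (n : ℝ) ^ 2 * hitProb l ε n k)
      (k * ((1 - l * ε ^ 2) / (1 - l * ε) ^ 3) + k * (k - 1) / (1 - l * ε) ^ 2) := by
  have hd : 1 - (l : ℝ) * ε ≠ 0 := (sub_pos.2 hlt).ne'
  have hA := fun k => hasSum_hitProb h0 h1 (Or.inl hlt) k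
  have hM := fun k => hasSum_id_mul_hitProb h0 h1 hlt k
  have hV := fun k => summable_sq_mul_hitProb hl h0 h1 hlt k
  obtain ⟨v, hv⟩ : ∃ v : ℕ → ℝ, v = fun k => ∑' n : ℕ, (n : ℝ) ^ 2 * hitProb l ε n k := ⟨_, rfl⟩
  have hVs : ∀ k, HasSum (fun n : ℕ => (n : ℝ) ^ 2 * hitProb l ε n k) (v k) := fun k => by
    rw [hv]; exact (hV k).hasSum
  have hadd : ∀ k : ℕ, v (k + 1) = v k + 2 * (k / (1 - l * ε) * (1 / (1 - l * ε))) + v 1 := by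
    intro k
    have e1 := hasSum_antidiagonal_mul (hV k) (hA 1).summable
    have e2 := hasSum_antidiagonal_mul (hM k).summable (hM 1).summable
    have e3 := hasSum_antidiagonal_mul (hA k).summable (hV 1)
    rw [(hA 1).tsum_eq, (hVs k).tsum_eq, mul_one] at e1
    rw [(hM k).tsum_eq, (hM 1).tsum_eq, Nat.cast_one] at e2
    rw [(hA k).tsum_eq, (hVs 1).tsum_eq, one_mul] at e3
    refine (hVs (k + 1)).unique ?_
    convert (e1.add (e2.mul_left 2)).add e3 using 1
    ext n
    rw [hitProb_add, Finset.mul_sum, Finset.mul_sum, ← Finset.sum_add_distrib,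
      ← Finset.sum_add_distrib]
    refine Finset.sum_congr rfl fun p hp => ?_
    obtain rfl := mem_antidiagonal.1 hp
    push_cast
    ring
  have hquad : ∀ k : ℕ, v k = k * v 1 + k * (k - 1) / (1 - l * ε) ^ 2 := by
    intro k
    induction k with
    | zero =>
      have := hadd 0
      simp only [zero_add, Nat.cast_zero, zero_div, zero_mul, mul_zero] at this ⊢
      linarith
    | succ k ih =>
      rw [hadd, ih]
      push_cast
      field_simp
      ring
  have hrec : v 1 = 1 / (1 - l * ε) ^ 2 * (l * (l - 1) * ε ^ 2 + l * ε) +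
      (v 1 - 1 / (1 - l * ε) ^ 2 + 2 / (1 - l * ε)) * (l * ε) + 1 := by
    have := hasSum_mul_hitProb_succ (l := l) (ε := ε) (u := fun n : ℕ => (n : ℝ) ^ 2) (k := 0)
      (U := fun j => v j + 2 * (j / (1 - l * ε)) + 1) (fun j => by
        convert ((hVs j).add ((hM j).mul_left 2)).add (hA j) using 1
        ext n
        push_cast
        ring)
    have h2 := sum_binomPmf_mul_quadratic ε (1 / (1 - l * ε) ^ 2)
      (v 1 - 1 / (1 - l * ε) ^ 2 + 2 / (1 - l * ε)) 1 l
    rw [← h2]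
    refine ((hVs 1).unique this).trans (Finset.sum_congr rfl fun j _ => ?_)
    rw [zero_add, hquad j]
    ring
  have h1' : v 1 = (1 - l * ε ^ 2) / (1 - l * ε) ^ 3 := by
    have : v 1 * (1 - l * ε) = 1 / (1 - l * ε) ^ 2 * (l * (l - 1) * ε ^ 2 + l * ε) +
      (- 1 / (1 - l * ε) ^ 2 + 2 / (1 - l * ε)) * (l * ε) + 1 := by
      linear_combination hrec
    rw [← mul_left_inj' hd, this]
    field_simp
    ring
  have := hVs k
  rwa [hquad, h1'] at this

theorem sum_range_binomPmf_succ_mul_quadratic (ε α β γ : ℝ) (l : ℕ) :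
    ∑ j ∈ Finset.range l, binomPmf ε l (j + 1) * (α * (j : ℝ) ^ 2 + β * j + γ) =
      α * (l * (l - 1) * ε ^ 2 + l * ε) + (β - 2 * α) * (l * ε) +
        (α - β + γ) * (1 - (1 - ε) ^ l) := by
  have := sum_binomPmf_mul_quadratic ε α (β - 2 * α) (α - β + γ) l
  rw [Finset.sum_range_succ', binomPmf_zero_right] at this
  have h2 : ∀ j ∈ Finset.range l, binomPmf ε l (j + 1) * (α * (j : ℝ) ^ 2 + β * j + γ) =
      binomPmf ε l (j + 1) * (α * ((j + 1 : ℕ) : ℝ) ^ 2 + (β - 2 * α) * ((j + 1 : ℕ) : ℝ) +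
        (α - β + γ)) := fun j _ => by push_cast; ring
  rw [Finset.sum_congr rfl h2]
  simp only [Nat.cast_zero] at this
  linear_combination this

/-- Sums against the law of the busy time, in terms of sums against the laws of the hitting times. -/
theorem hasSum_mul_busyPmf {l : ℕ} (hl : 1 ≤ l) {ε α β γ : ℝ} {u : ℕ → ℝ}
    (hU : ∀ j : ℕ, HasSum (fun n => u (n + 1) * hitProb l ε n j) (α * (j : ℝ) ^ 2 + β * j + γ)) :
    HasSum (fun s => u s * busyPmf l ε s)
      (α * (l * (l - 1) * ε ^ 2 + l * ε) + (β - 2 * α) * (l * ε) +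
        (α - β + γ) * (1 - (1 - ε) ^ l) - u 1 * (ε * (1 - ε) ^ (l - 1)) +
        u 0 * (1 - ε) ^ (l - 1)) := by
  have he : HasSum (fun s => u (s + 1) * excursionProb l ε s)
      (∑ j ∈ Finset.range l, binomPmf ε l (j + 1) * (α * (j : ℝ) ^ 2 + β * j + γ)) := by
    simp only [excursionProb, Finset.mul_sum]
    refine hasSum_sum fun j _ => ?_
    simpa only [mul_left_comm] using (hU j).mul_left (binomPmf ε l (j + 1))
  rw [sum_range_binomPmf_succ_mul_quadratic] at he
  have hs := hasSum_ite_eq (0 : ℕ) (u 1 * (ε * (1 - ε) ^ (l - 1)))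
  rw [← hasSum_nat_add_iff' 1]
  convert he.sub hs using 1
  · ext s
    rw [busyPmf_succ hl]
    split_ifs with h
    · subst h; ring
    · ring
  · simp [busyPmf]

theorem hasSum_busyPmf {l : ℕ} (hl : 1 ≤ l) {ε : ℝ} (h0 : 0 ≤ ε) (h1 : ε ≤ 1)
    (hle : (l : ℝ) * ε ≤ 1) : HasSum (busyPmf l ε) 1 := by
  rcases hl.eq_or_lt with rfl | hl2
  · have : busyPmf 1 ε = fun s => if s = 0 then 1 else 0 := by
      ext s
      rw [busyPmf]
      split_ifs <;> simp
    rw [this]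
    exact hasSum_ite_eq (0 : ℕ) (1 : ℝ)
  · have hU : ∀ j : ℕ, HasSum (fun n => (1 : ℝ) * hitProb l ε n j)
        (0 * (j : ℝ) ^ 2 + 0 * j + 1) := fun j => by
      simpa using hasSum_hitProb h0 h1 (Or.inr ⟨hl2, hle⟩) j
    have key := hasSum_mul_busyPmf (u := fun _ => 1) hl hU
    simp only [one_mul] at key
    convert key using 1
    obtain ⟨l, rfl⟩ : ∃ l', l = l' + 1 := ⟨l - 1, by omega⟩
    rw [Nat.add_sub_cancel]
    ring

theorem hasSum_id_mul_busyPmf {l : ℕ} (hl : 1 ≤ l) {ε : ℝ} (h0 : 0 ≤ ε) (h1 : ε ≤ 1)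
    (hlt : (l : ℝ) * ε < 1) :
    HasSum (fun s : ℕ => (s : ℝ) * busyPmf l ε s)
      (((l : ℝ) - 1) * ε * (1 - ε) ^ (l - 1) / (1 - l * ε)) := by
  have hd : 1 - (l : ℝ) * ε ≠ 0 := (sub_pos.2 hlt).ne'
  have hU : ∀ j : ℕ, HasSum (fun n : ℕ => ((n + 1 : ℕ) : ℝ) * hitProb l ε n j)
      (0 * (j : ℝ) ^ 2 + 1 / (1 - l * ε) * j + 1) := fun j => by
    convert (hasSum_id_mul_hitProb h0 h1 hlt j).add (hasSum_hitProb h0 h1 (Or.inl hlt) j) using 1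
    · ext n
      push_cast
      ring
    · ring
  have key := hasSum_mul_busyPmf (u := fun n => (n : ℝ)) hl hU
  convert key using 1
  obtain ⟨l, rfl⟩ : ∃ l', l = l' + 1 := ⟨l - 1, by omega⟩
  rw [Nat.add_sub_cancel]
  push_cast at hd ⊢
  field_simp
  ring

theorem hasSum_sq_mul_busyPmf {l : ℕ} (hl : 1 ≤ l) {ε : ℝ} (h0 : 0 ≤ ε) (h1 : ε ≤ 1)
    (hlt : (l : ℝ) * ε < 1) :
    HasSum (fun s : ℕ => (s : ℝ) ^ 2 * busyPmf l ε s)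
      (((l : ℝ) - 1) * ε * (1 - ε) ^ (l - 1) / (1 - l * ε) +
        l * ((l : ℝ) - 1) * ε ^ 2 * (1 - ε) ^ l / (1 - l * ε) ^ 3) := by
  have hd : 1 - (l : ℝ) * ε ≠ 0 := (sub_pos.2 hlt).ne'
  have hU : ∀ j : ℕ, HasSum (fun n : ℕ => ((n + 1 : ℕ) : ℝ) ^ 2 * hitProb l ε n j)
      (1 / (1 - l * ε) ^ 2 * (j : ℝ) ^ 2 + ((1 - l * ε ^ 2) / (1 - l * ε) ^ 3 -
        1 / (1 - l * ε) ^ 2 + 2 / (1 - l * ε)) * j + 1) := fun j => by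
    convert ((hasSum_sq_mul_hitProb hl h0 h1 hlt j).add
      ((hasSum_id_mul_hitProb h0 h1 hlt j).mul_left 2)).add
      (hasSum_hitProb h0 h1 (Or.inl hlt) j) using 1
    · ext n
      push_cast
      ring
    · ring
  have key := hasSum_mul_busyPmf (u := fun n => (n : ℝ) ^ 2) hl hU
  convert key using 1
  obtain ⟨l, rfl⟩ : ∃ l', l = l' + 1 := ⟨l - 1, by omega⟩
  rw [Nat.add_sub_cancel]
  push_cast at hd ⊢
  field_simp
  ring

/-! ### The law of a period -/

open MeasureTheory ProbabilityTheory

/-- The σ-algebra generated by the erasures of the slots `i + 1` with `i ∈ S`. -/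
@[reducible]
def slotAlgebra {Ω : Type*} (e : ℕ → Set Ω) (S : Set ℕ) : MeasurableSpace Ω :=
  ⨆ i ∈ S, MeasurableSpace.generateFrom {e (i + 1)}

section Measurability

variable {Ω : Type*} {e : ℕ → Set Ω}

theorem slotAlgebra_mono {S T : Set ℕ} (h : S ⊆ T) : slotAlgebra e S ≤ slotAlgebra e T :=
  biSup_mono h

theorem measurableSet_slotAlgebra {S : Set ℕ} {i : ℕ} (hi : i ∈ S) :
    MeasurableSet[slotAlgebra e S] (e (i + 1)) := by
  have h : MeasurableSpace.generateFrom {e (i + 1)} ≤ slotAlgebra e S :=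
    le_biSup (fun i => MeasurableSpace.generateFrom {e (i + 1)}) hi
  exact h _ (MeasurableSpace.measurableSet_generateFrom rfl)

theorem slotAlgebra_le {m : MeasurableSpace Ω} (he : ∀ t, 1 ≤ t → MeasurableSet (e t))
    (S : Set ℕ) : slotAlgebra e S ≤ m := by
  refine iSup₂_le fun i _ => MeasurableSpace.generateFrom_le ?_
  rintro _ rfl
  exact he _ (Nat.succ_pos i)

theorem measurable_erasures {S : Set ℕ} {a n : ℕ} (h : Set.Ico a (a + n) ⊆ S) :
    Measurable[slotAlgebra e S] fun ω => erasures (erasedSlots e ω) a n := by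
  classical
  let _ := slotAlgebra e S
  induction n with
  | zero => simp [erasures]
  | succ n ih =>
    simp only [erasures_succ]
    have hS : a + n ∈ S := h ⟨by omega, by omega⟩
    refine (ih fun i hi => h ⟨hi.1, by have := hi.2; omega⟩).add ?_
    exact Measurable.ite (measurableSet_slotAlgebra hS) measurable_const measurable_const

theorem measurableSet_hits {l n b : ℕ} {S : Set ℕ} {K : Ω → ℕ}
    (hS : Set.Ico (b * l) ((b + n) * l) ⊆ S) (hK : Measurable[slotAlgebra e S] K) :
    MeasurableSet[slotAlgebra e S] {ω | Hits l (erasedSlots e ω) n b (K ω)} := by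
  let _ := slotAlgebra e S
  have hW : ∀ i ≤ n, Measurable fun ω => K ω + erasures (erasedSlots e ω) (b * l) (i * l) := by
    refine fun i hi => hK.add (measurable_erasures (Set.Subset.trans (Set.Ico_subset_Ico_right ?_) hS))
    rw [← add_mul]
    exact Nat.mul_le_mul_right l (by omega)
  have h1 : MeasurableSet (⋂ i ∈ Set.Iio n,
      {ω | i < K ω + erasures (erasedSlots e ω) (b * l) (i * l)}) := by
    refine MeasurableSet.biInter (Set.to_countable _) fun i hi => ?_
    exact hW i (le_of_lt hi) (MeasurableSet.of_discrete (s := {x | i < x}))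
  have h2 : MeasurableSet {ω | K ω + erasures (erasedSlots e ω) (b * l) (n * l) = n} :=
    hW n le_rfl (MeasurableSet.of_discrete (s := {x | x = n}))
  convert h1.inter h2 using 1
  ext ω
  simp [Hits]

theorem measurableSet_periodValue_zero {l b : ℕ} (hl : 1 ≤ l) {S : Set ℕ}
    (hS : Set.Ico (b * l) ((b + 1) * l) ⊆ S) :
    MeasurableSet[slotAlgebra e S] {ω | periodValue l (erasedSlots e ω) (b * l) = 0} := by
  simp only [periodValue_eq_zero_iff hl]
  have : Measurable[slotAlgebra e S] fun ω => erasures (erasedSlots e ω) (b * l) (l - 1) := by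
    refine measurable_erasures (Set.Subset.trans (Set.Ico_subset_Ico_right ?_) hS)
    rw [add_mul, one_mul]
    omega
  exact this (MeasurableSet.of_discrete (s := {x | x = 0}))

theorem measurableSet_periodValue_succ {l b s : ℕ} (hl : 1 ≤ l) {S : Set ℕ}
    (hS : Set.Ico (b * l) ((b + s + 1) * l) ⊆ S) :
    MeasurableSet[slotAlgebra e S]
      {ω | periodValue l (erasedSlots e ω) (b * l) = ((s + 1 : ℕ) : ℕ∞)} := by
  simp only [periodValue_eq_succ_iff hl]
  have hle : b * l + l ≤ (b + s + 1) * l := by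
    rw [← Nat.succ_mul]
    exact Nat.mul_le_mul_right l (by omega)
  have h1 : Measurable[slotAlgebra e S] fun ω => erasures (erasedSlots e ω) (b * l) (l - 1) :=
    measurable_erasures (Set.Subset.trans (Set.Ico_subset_Ico_right (by omega)) hS)
  have h2 : Measurable[slotAlgebra e S] fun ω => erasures (erasedSlots e ω) (b * l) l - 1 :=
    (measurable_from_top (f := fun x : ℕ => x - 1)).comp
      (measurable_erasures (Set.Subset.trans (Set.Ico_subset_Ico_right hle) hS))
  refine MeasurableSet.inter (h1 (MeasurableSet.of_discrete (s := {x | 0 < x})))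
    (measurableSet_hits (Set.Subset.trans (Set.Ico_subset_Ico ?_ ?_) hS) h2)
  · exact Nat.mul_le_mul_right l (by omega)
  · exact Nat.mul_le_mul_right l (by omega)

theorem measurableSet_periodValue {l b : ℕ} (hl : 1 ≤ l) (s : ℕ) :
    MeasurableSet[slotAlgebra e (Set.Ici (b * l))]
      {ω | periodValue l (erasedSlots e ω) (b * l) = (s : ℕ∞)} := by
  cases s with
  | zero => exact measurableSet_periodValue_zero hl Set.Ico_subset_Ici_self
  | succ s => exact measurableSet_periodValue_succ hl Set.Ico_subset_Ici_self

/-- Whether a period starts after slot `c * l` is decided by the erasures up to that slot. -/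
theorem measurableSet_periodStart {l : ℕ} (hl : 1 ≤ l) (j c : ℕ) :
    MeasurableSet[slotAlgebra e (Set.Iio (c * l))]
      {ω | periodStart l (erasedSlots e ω) j = ((c * l : ℕ) : ℕ∞)} := by
  induction j generalizing c with
  | zero =>
    simp only [periodStart]
    exact MeasurableSet.const _
  | succ j ih =>
    simp only [periodStart_succ_eq_iff hl, Set.ofPred_exists]
    refine MeasurableSet.iUnion fun b => ?_
    simp only [periodEnd_eq_coe_mul_iff hl]
    by_cases hbc : b < c
    · refine MeasurableSet.inter (slotAlgebra_mono (Set.Iio_subset_Iio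
        (Nat.mul_le_mul_right l hbc.le)) _ (ih b)) (MeasurableSet.union ?_ ?_)
      · refine MeasurableSet.inter (MeasurableSet.const _) (measurableSet_periodValue_zero hl ?_)
        exact fun i hi => lt_of_lt_of_le hi.2 (Nat.mul_le_mul_right l hbc)
      · have hU : {ω : Ω | ∃ s : ℕ, c = b + s + 1 ∧
            periodValue l (erasedSlots e ω) (b * l) = ((s + 1 : ℕ) : ℕ∞)} =
            ⋃ s : ℕ, {ω | c = b + s + 1 ∧
              periodValue l (erasedSlots e ω) (b * l) = ((s + 1 : ℕ) : ℕ∞)} := by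
          rw [← Set.ofPred_exists]
        refine (congrArg (MeasurableSet[slotAlgebra e (Set.Iio (c * l))]) hU).mpr
          (MeasurableSet.iUnion fun s => ?_)
        by_cases hc : c = b + s + 1
        · simp only [eq_true hc, true_and]
          exact measurableSet_periodValue_succ hl fun i hi => hc ▸ hi.2
        · simp only [hc, false_and]
          exact MeasurableSet.const _
    · convert MeasurableSet.empty using 1
      ext ω
      simp only [Set.mem_ofPred_eq, Set.mem_empty_iff_false, iff_false]
      rintro ⟨-, ⟨h, -⟩ | ⟨s, h, -⟩⟩ <;> omega

theorem setOf_busyTime_eq_top_compl (l : ℕ) (e : ℕ → Set Ω) (j : ℕ) :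
    {ω | busyTime l (erasedSlots e ω) j = ⊤}ᶜ =
      ⋃ s : ℕ, {ω | busyTime l (erasedSlots e ω) j = (s : ℕ∞)} := by
  ext ω
  simp only [Set.mem_compl_iff, Set.mem_ofPred_eq, Set.mem_iUnion]
  rw [← Ne, ENat.ne_top_iff_exists]
  simp only [eq_comm]

end Measurability

section Law

variable {Ω : Type*} [MeasurableSpace Ω] {μ : Measure Ω} {e : ℕ → Set Ω} {ε : ℝ} {l : ℕ}

theorem measure_inter_of_disjoint (he_meas : ∀ t, 1 ≤ t → MeasurableSet (e t))
    (he_indep : iIndepSet (fun n : ℕ => e (n + 1)) μ) {S T : Set ℕ} (hST : Disjoint S T)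
    {A B : Set Ω} (hA : MeasurableSet[slotAlgebra e S] A)
    (hB : MeasurableSet[slotAlgebra e T] B) : μ (A ∩ B) = μ A * μ B := by
  refine (Indep_iff _ _ μ).1 (indep_iSup_of_disjoint (fun i => ?_) he_indep hST) A B hA hB
  refine MeasurableSpace.generateFrom_le ?_
  rintro _ rfl
  exact he_meas _ (Nat.succ_pos i)

theorem measureReal_inter_of_disjoint (he_meas : ∀ t, 1 ≤ t → MeasurableSet (e t))
    (he_indep : iIndepSet (fun n : ℕ => e (n + 1)) μ) {S T : Set ℕ} (hST : Disjoint S T)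
    {A B : Set Ω} (hA : MeasurableSet[slotAlgebra e S] A)
    (hB : MeasurableSet[slotAlgebra e T] B) : μ.real (A ∩ B) = μ.real A * μ.real B := by
  simp only [measureReal_def, measure_inter_of_disjoint he_meas he_indep hST hA hB,
    ENNReal.toReal_mul]

theorem measureReal_eq_sum_fiber [IsFiniteMeasure μ] {f : Ω → ℕ} (hf : Measurable f) {N : ℕ}
    (hN : ∀ ω, f ω < N) {A : Set Ω} (hA : MeasurableSet A) :
    μ.real A = ∑ j ∈ Finset.range N, μ.real ({ω | f ω = j} ∩ A) := by
  rw [← measureReal_biUnion_finset]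
  · congr 1
    ext ω
    simp [hN]
  · intro i _ j _ hij
    refine Set.disjoint_left.2 ?_
    rintro ω ⟨rfl, -⟩ ⟨h, -⟩
    exact hij h
  · exact fun j _ => (hf (MeasurableSet.of_discrete (s := {x | x = j}))).inter hA

theorem measureReal_erased (hε0 : 0 ≤ ε) (he_prob : ∀ t, 1 ≤ t → μ (e t) = ENNReal.ofReal ε)
    (i : ℕ) : μ.real (e (i + 1)) = ε := by
  rw [measureReal_def, he_prob _ (Nat.succ_pos i), ENNReal.toReal_ofReal hε0]

theorem measureReal_erasures_eq [IsProbabilityMeasure μ] (hε0 : 0 ≤ ε)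
    (he_meas : ∀ t, 1 ≤ t → MeasurableSet (e t))
    (he_indep : iIndepSet (fun n : ℕ => e (n + 1)) μ)
    (he_prob : ∀ t, 1 ≤ t → μ (e t) = ENNReal.ofReal ε) (a n j : ℕ) :
    μ.real {ω | erasures (erasedSlots e ω) a n = j} = binomPmf ε n j := by
  classical
  induction n generalizing j with
  | zero =>
    cases j with
    | zero => simp [erasures, binomPmf]
    | succ j => simp [erasures, binomPmf]
  | succ n ih =>
    have hdisj : Disjoint (Set.Ico a (a + n)) {a + n} := by simp
    have hm : ∀ j, MeasurableSet[slotAlgebra e (Set.Ico a (a + n))]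
        {ω | erasures (erasedSlots e ω) a n = j} := fun j =>
      measurable_erasures le_rfl (MeasurableSet.of_discrete (s := {x | x = j}))
    have he : MeasurableSet[slotAlgebra e {a + n}] (e (a + n + 1)) :=
      measurableSet_slotAlgebra rfl
    have hin : ∀ j, μ.real ({ω | erasures (erasedSlots e ω) a n = j} ∩ e (a + n + 1)) =
        ε * binomPmf ε n j := fun j => by
      rw [measureReal_inter_of_disjoint he_meas he_indep hdisj (hm j) he, ih,
        measureReal_erased hε0 he_prob, mul_comm]
    have hout : ∀ j, μ.real ({ω | erasures (erasedSlots e ω) a n = j} ∩ (e (a + n + 1))ᶜ) =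
        (1 - ε) * binomPmf ε n j := fun j => by
      rw [measureReal_inter_of_disjoint he_meas he_indep hdisj (hm j) he.compl, ih,
        probReal_compl_eq_one_sub (he_meas _ (Nat.succ_pos _)),
        measureReal_erased hε0 he_prob, mul_comm]
    cases j with
    | zero =>
      rw [binomPmf_zero_right, pow_succ', ← binomPmf_zero_right, ← hout]
      congr 1
      ext ω
      simp only [Set.mem_ofPred_eq, erasures_succ, erasedSlots, Set.mem_inter_iff, Set.mem_compl_iff]
      split_ifs with h <;> simp [h]
    | succ j =>
      rw [binomPmf_succ_succ, ← hin, ← hout, ← measureReal_union]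
      · congr 1
        ext ω
        simp only [Set.mem_ofPred_eq, erasures_succ, erasedSlots, Set.mem_union, Set.mem_inter_iff,
          Set.mem_compl_iff]
        split_ifs with h <;> simp [h]
      · exact Set.disjoint_left.2 fun ω h h' => h'.2 h.2
      · exact (slotAlgebra_le he_meas _ _ (hm _)).inter (he_meas _ (Nat.succ_pos _)).compl

theorem measureReal_hits [IsProbabilityMeasure μ] (hε0 : 0 ≤ ε)
    (he_meas : ∀ t, 1 ≤ t → MeasurableSet (e t))
    (he_indep : iIndepSet (fun n : ℕ => e (n + 1)) μ)
    (he_prob : ∀ t, 1 ≤ t → μ (e t) = ENNReal.ofReal ε) (n b k : ℕ) :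
    μ.real {ω | Hits l (erasedSlots e ω) n b k} = hitProb l ε n k := by
  induction n generalizing b k with
  | zero =>
    simp only [hits_zero, hitProb]
    split_ifs with h <;> simp [h]
  | succ n ih =>
    cases k with
    | zero => simp [not_hits_succ_zero, hitProb]
    | succ k =>
      simp only [hits_succ_succ]
      have hZ : Measurable[slotAlgebra e (Set.Ico (b * l) (b * l + l))]
        fun ω => erasures (erasedSlots e ω) (b * l) l := measurable_erasures le_rfl
      have hZ' : Measurable fun ω => erasures (erasedSlots e ω) (b * l) l :=
        hZ.mono (slotAlgebra_le he_meas _) le_rfl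
      rw [measureReal_eq_sum_fiber hZ'
        (fun ω => Nat.lt_succ_of_le (erasures_le (erasedSlots e ω) (b * l) l)), hitProb]
      · refine Finset.sum_congr rfl fun j _ => ?_
        rw [← ih (b + 1) (k + j), ← measureReal_erasures_eq hε0 he_meas he_indep he_prob (b * l) l j,
          ← measureReal_inter_of_disjoint (S := Set.Ico (b * l) (b * l + l))
            (T := Set.Ici ((b + 1) * l)) he_meas he_indep]
        · congr 1
          ext ω
          simp only [Set.mem_inter_iff, Set.mem_ofPred_eq]
          exact and_congr_right fun h => by rw [h]
        · rw [show (b + 1) * l = b * l + l by ring]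
          exact Set.disjoint_left.2 fun i hi hi' => absurd hi.2 (not_lt.2 hi')
        · exact hZ (MeasurableSet.of_discrete (s := {x | x = j}))
        · exact measurableSet_hits Set.Ico_subset_Ici_self measurable_const
      · refine slotAlgebra_le he_meas Set.univ _ (measurableSet_hits (Set.subset_univ _) ?_)
        exact measurable_const.add (measurable_erasures (Set.subset_univ _))

theorem measureReal_excursion [IsProbabilityMeasure μ] (hε0 : 0 ≤ ε)
    (he_meas : ∀ t, 1 ≤ t → MeasurableSet (e t))
    (he_indep : iIndepSet (fun n : ℕ => e (n + 1)) μ)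
    (he_prob : ∀ t, 1 ≤ t → μ (e t) = ENNReal.ofReal ε) (s b : ℕ) :
    μ.real {ω | 0 < erasures (erasedSlots e ω) (b * l) l ∧
      Hits l (erasedSlots e ω) s (b + 1) (erasures (erasedSlots e ω) (b * l) l - 1)} =
        excursionProb l ε s := by
  have hZ : Measurable[slotAlgebra e (Set.Ico (b * l) (b * l + l))]
    fun ω => erasures (erasedSlots e ω) (b * l) l := measurable_erasures le_rfl
  have hZ' : Measurable fun ω => erasures (erasedSlots e ω) (b * l) l :=
    hZ.mono (slotAlgebra_le he_meas _) le_rfl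
  rw [measureReal_eq_sum_fiber hZ'
    (fun ω => Nat.lt_succ_of_le (erasures_le (erasedSlots e ω) (b * l) l)),
    Finset.sum_range_succ', excursionProb]
  · have h0 : {ω | erasures (erasedSlots e ω) (b * l) l = 0} ∩
        {ω | 0 < erasures (erasedSlots e ω) (b * l) l ∧
          Hits l (erasedSlots e ω) s (b + 1) (erasures (erasedSlots e ω) (b * l) l - 1)} = ∅ := by
      ext ω
      simp only [Set.mem_inter_iff, Set.mem_ofPred_eq, Set.mem_empty_iff_false, iff_false]
      rintro ⟨h, h', -⟩
      omega
    rw [h0, measureReal_empty, add_zero]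
    refine Finset.sum_congr rfl fun j _ => ?_
    rw [← measureReal_hits hε0 he_meas he_indep he_prob s (b + 1) j,
      ← measureReal_erasures_eq hε0 he_meas he_indep he_prob (b * l) l (j + 1),
      ← measureReal_inter_of_disjoint (S := Set.Ico (b * l) (b * l + l))
        (T := Set.Ici ((b + 1) * l)) he_meas he_indep]
    · congr 1
      ext ω
      simp only [Set.mem_inter_iff, Set.mem_ofPred_eq]
      exact and_congr_right fun h => by simp [h]
    · rw [show (b + 1) * l = b * l + l by ring]
      exact Set.disjoint_left.2 fun i hi hi' => absurd hi.2 (not_lt.2 hi')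
    · exact hZ (MeasurableSet.of_discrete (s := {x | x = j + 1}))
    · exact measurableSet_hits Set.Ico_subset_Ici_self measurable_const
  · refine (hZ' (MeasurableSet.of_discrete (s := {x | 0 < x}))).inter
      (slotAlgebra_le he_meas Set.univ _ (measurableSet_hits (Set.subset_univ _) ?_))
    exact (measurable_from_top (f := fun x : ℕ => x - 1)).comp
      (measurable_erasures (Set.subset_univ _))

theorem measureReal_periodValue [IsProbabilityMeasure μ] (hl : 1 ≤ l) (hε0 : 0 ≤ ε)
    (he_meas : ∀ t, 1 ≤ t → MeasurableSet (e t))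
    (he_indep : iIndepSet (fun n : ℕ => e (n + 1)) μ)
    (he_prob : ∀ t, 1 ≤ t → μ (e t) = ENNReal.ofReal ε) (b s : ℕ) :
    μ.real {ω | periodValue l (erasedSlots e ω) (b * l) = (s : ℕ∞)} = busyPmf l ε s := by
  classical
  cases s with
  | zero =>
    simp only [Nat.cast_zero, periodValue_eq_zero_iff hl]
    rw [measureReal_erasures_eq hε0 he_meas he_indep he_prob, binomPmf_zero_right, busyPmf,
      if_pos rfl]
  | succ s =>
    have hZX : ∀ ω, erasures (erasedSlots e ω) (b * l) l =
        erasures (erasedSlots e ω) (b * l) (l - 1) +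
          if b * l + (l - 1) + 1 ∈ erasedSlots e ω then 1 else 0 := fun ω => by
      conv_lhs => rw [show l = l - 1 + 1 by omega]
      rw [show b * (l - 1 + 1) = b * l by rw [Nat.sub_add_cancel hl], erasures_succ]
    -- The excursions that do not count as busy periods.
    have hcoded : μ.real ({ω | erasures (erasedSlots e ω) (b * l) (l - 1) = 0 ∧
        b * l + (l - 1) + 1 ∈ erasedSlots e ω ∧ s = 0}) =
          if s = 0 then ε * (1 - ε) ^ (l - 1) else 0 := by
      split_ifs with hs
      · have hX : MeasurableSet[slotAlgebra e (Set.Ico (b * l) (b * l + (l - 1)))]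
            {ω | erasures (erasedSlots e ω) (b * l) (l - 1) = 0} :=
          measurable_erasures le_rfl (MeasurableSet.of_discrete (s := {x | x = 0}))
        have hinter := measureReal_inter_of_disjoint he_meas he_indep
          (by simp : Disjoint (Set.Ico (b * l) (b * l + (l - 1))) {b * l + (l - 1)}) hX
          (measurableSet_slotAlgebra rfl)
        rw [measureReal_erased hε0 he_prob,
          measureReal_erasures_eq hε0 he_meas he_indep he_prob, binomPmf_zero_right] at hinter
        rw [mul_comm ε, ← hinter]
        congr 1
        ext ω
        simp [hs, erasedSlots]
      · simp [hs]
    rw [busyPmf_succ hl, ← measureReal_excursion hε0 he_meas he_indep he_prob s b, ← hcoded,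
      eq_sub_iff_add_eq, ← measureReal_union]
    · congr 1
      ext ω
      simp only [Set.mem_union, Set.mem_ofPred_eq, periodValue_eq_succ_iff hl]
      have hZ := hZX ω
      constructor
      · rintro (⟨h1, h2⟩ | ⟨h1, h2, rfl⟩)
        · exact ⟨by omega, h2⟩
        · rw [if_pos h2, h1] at hZ
          exact ⟨by omega, hits_zero.2 (by omega)⟩
      · rintro ⟨h1, h2⟩
        by_cases hX : erasures (erasedSlots e ω) (b * l) (l - 1) = 0
        · have hmem : b * l + (l - 1) + 1 ∈ erasedSlots e ω := by
            by_contra h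
            rw [if_neg h] at hZ
            omega
          refine Or.inr ⟨hX, hmem, ?_⟩
          rw [if_pos hmem, hX] at hZ
          rw [hZ] at h2
          rcases Nat.eq_zero_or_pos s with h | h
          · exact h
          · obtain ⟨s, rfl⟩ : ∃ s', s = s' + 1 := ⟨s - 1, by omega⟩
            exact absurd h2 not_hits_succ_zero
        · exact Or.inl ⟨Nat.pos_of_ne_zero hX, h2⟩
    · refine Set.disjoint_left.2 ?_
      rintro ω h1 h2
      have := ((periodValue_eq_succ_iff hl).1 h1).1
      exact this.ne' h2.1
    · refine MeasurableSet.inter ?_ (MeasurableSet.inter (he_meas _ (Nat.succ_pos _))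
        (MeasurableSet.const _))
      exact slotAlgebra_le he_meas Set.univ _ (measurable_erasures (Set.subset_univ _)
        (MeasurableSet.of_discrete (s := {x | x = 0})))

/-! ### The law of the `j`-th period -/

theorem measurableSet_busyTime_eq (hl : 1 ≤ l) (he_meas : ∀ t, 1 ≤ t → MeasurableSet (e t))
    (j s : ℕ) : MeasurableSet {ω | busyTime l (erasedSlots e ω) j = (s : ℕ∞)} := by
  simp only [busyTime_eq_coe_iff hl, Set.ofPred_exists]
  exact MeasurableSet.iUnion fun b =>
    (slotAlgebra_le he_meas _ _ (measurableSet_periodStart hl j b)).inter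
      (slotAlgebra_le he_meas _ _ (measurableSet_periodValue hl s))

/-- The start of a period depends only on the past and its busy time only on the future. -/
theorem measure_busyTime_eq [IsProbabilityMeasure μ] (hl : 1 ≤ l) (hε0 : 0 ≤ ε)
    (he_meas : ∀ t, 1 ≤ t → MeasurableSet (e t))
    (he_indep : iIndepSet (fun n : ℕ => e (n + 1)) μ)
    (he_prob : ∀ t, 1 ≤ t → μ (e t) = ENNReal.ofReal ε) (j s : ℕ) :
    μ {ω | busyTime l (erasedSlots e ω) j = (s : ℕ∞)} =
      ENNReal.ofReal (busyPmf l ε s) * μ {ω | periodStart l (erasedSlots e ω) j ≠ ⊤} := by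
  have hdisj : ∀ ω, ∀ b c : ℕ, periodStart l (erasedSlots e ω) j = ((b * l : ℕ) : ℕ∞) →
      periodStart l (erasedSlots e ω) j = ((c * l : ℕ) : ℕ∞) → b = c := by
    intro ω b c h1 h2
    rw [h1, Nat.cast_inj, Nat.mul_left_inj (by omega)] at h2
    exact h2
  have hstart := fun b =>
    slotAlgebra_le he_meas _ _ (measurableSet_periodStart (e := e) hl j b)
  have hs : {ω | periodStart l (erasedSlots e ω) j ≠ ⊤} =
      ⋃ b : ℕ, {ω | periodStart l (erasedSlots e ω) j = ((b * l : ℕ) : ℕ∞)} := by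
    ext ω
    simp only [Set.mem_ofPred_eq, Set.mem_iUnion]
    refine ⟨exists_periodStart_eq hl, ?_⟩
    rintro ⟨b, hb⟩
    rw [hb]
    exact ENat.natCast_ne_top _
  have h1 : μ (⋃ b : ℕ, {ω | periodStart l (erasedSlots e ω) j = ((b * l : ℕ) : ℕ∞)}) =
      ∑' b : ℕ, μ {ω | periodStart l (erasedSlots e ω) j = ((b * l : ℕ) : ℕ∞)} :=
    measure_iUnion (fun b c hbc => Set.disjoint_left.2 fun ω h1 h2 => hbc (hdisj ω b c h1 h2)) hstart
  have h2 : {ω | busyTime l (erasedSlots e ω) j = (s : ℕ∞)} =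
      ⋃ b : ℕ, {ω | periodStart l (erasedSlots e ω) j = ((b * l : ℕ) : ℕ∞)} ∩
        {ω | periodValue l (erasedSlots e ω) (b * l) = (s : ℕ∞)} := by
    ext ω
    simp only [busyTime_eq_coe_iff hl, Set.mem_ofPred_eq, Set.mem_iUnion, Set.mem_inter_iff]
  rw [hs, h1, h2, ← ENNReal.tsum_mul_left, measure_iUnion (fun b c hbc =>
    Set.disjoint_left.2 fun ω h1 h2 => hbc (hdisj ω b c h1.1 h2.1)) (fun b => (hstart b).inter
      (slotAlgebra_le he_meas _ _ (measurableSet_periodValue hl s)))]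
  refine tsum_congr fun b => ?_
  rw [← measureReal_periodValue hl hε0 he_meas he_indep he_prob b s, ofReal_measureReal,
    mul_comm (μ _)]
  refine measure_inter_of_disjoint he_meas he_indep (S := Set.Iio (b * l)) (T := Set.Ici (b * l))
    ?_ (measurableSet_periodStart hl j b) (measurableSet_periodValue hl s)
  exact Set.disjoint_left.2 fun i hi hi' => absurd (Set.mem_Iio.1 hi) (not_lt.2 hi')

theorem busyPmf_nonneg (hl : 1 ≤ l) (hε0 : 0 ≤ ε) (hε1 : ε ≤ 1) (s : ℕ) :
    0 ≤ busyPmf l ε s := by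
  have h1 : (0 : ℝ) ≤ l - 1 := sub_nonneg.2 (by exact_mod_cast hl)
  have h2 := sub_nonneg.2 hε1
  rw [busyPmf]
  split_ifs <;> positivity

theorem measurableSet_busyTime_eq_top (hl : 1 ≤ l)
    (he_meas : ∀ t, 1 ≤ t → MeasurableSet (e t)) (j : ℕ) :
    MeasurableSet {ω | busyTime l (erasedSlots e ω) j = ⊤} := by
  rw [← MeasurableSet.compl_iff, setOf_busyTime_eq_top_compl]
  exact MeasurableSet.iUnion fun s => measurableSet_busyTime_eq hl he_meas j s

/-- Up to capacity the claimed law has total mass `1`, so a period that takes place almost surely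
ends almost surely. -/
theorem measure_busyTime_eq_top_of_periodStart [IsProbabilityMeasure μ] (hl : 1 ≤ l) (hε0 : 0 ≤ ε)
    (hε1 : ε ≤ 1) (he_meas : ∀ t, 1 ≤ t → MeasurableSet (e t))
    (he_indep : iIndepSet (fun n : ℕ => e (n + 1)) μ)
    (he_prob : ∀ t, 1 ≤ t → μ (e t) = ENNReal.ofReal ε) (hle : (l : ℝ) * ε ≤ 1) {j : ℕ}
    (hj : μ {ω | periodStart l (erasedSlots e ω) j ≠ ⊤} = 1) :
    μ {ω | busyTime l (erasedSlots e ω) j = ⊤} = 0 := by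
  rw [← prob_compl_eq_one_iff (measurableSet_busyTime_eq_top hl he_meas j),
    setOf_busyTime_eq_top_compl, measure_iUnion _
      (fun s => measurableSet_busyTime_eq hl he_meas j s)]
  · simp only [measure_busyTime_eq hl hε0 he_meas he_indep he_prob, hj, mul_one]
    have hp := hasSum_busyPmf hl hε0 hε1 hle
    rw [← ENNReal.ofReal_tsum_of_nonneg (busyPmf_nonneg hl hε0 hε1) hp.summable, hp.tsum_eq,
      ENNReal.ofReal_one]
  · intro s s' hss
    refine Set.disjoint_left.2 fun ω h1 h2 => hss ?_
    have : ((s : ℕ) : ℕ∞) = s' := h1.symm.trans h2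
    exact_mod_cast this

theorem measure_periodStart_ne_top [IsProbabilityMeasure μ] (hl : 1 ≤ l) (hε0 : 0 ≤ ε)
    (hε1 : ε ≤ 1) (he_meas : ∀ t, 1 ≤ t → MeasurableSet (e t))
    (he_indep : iIndepSet (fun n : ℕ => e (n + 1)) μ)
    (he_prob : ∀ t, 1 ≤ t → μ (e t) = ENNReal.ofReal ε) (hle : (l : ℝ) * ε ≤ 1) (j : ℕ) :
    μ {ω | periodStart l (erasedSlots e ω) j ≠ ⊤} = 1 := by
  induction j with
  | zero => simp [periodStart]
  | succ j ih =>
    have h : {ω | periodStart l (erasedSlots e ω) (j + 1) ≠ ⊤} =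
        {ω | busyTime l (erasedSlots e ω) j = ⊤}ᶜ := by
      ext ω
      exact not_congr periodStart_succ_eq_top_iff
    rw [h, prob_compl_eq_one_iff (measurableSet_busyTime_eq_top hl he_meas j)]
    exact measure_busyTime_eq_top_of_periodStart hl hε0 hε1 he_meas he_indep he_prob hle ih

/-- Expectations of functions of an almost surely finite busy time. -/
theorem lintegral_busyTime (hl : 1 ≤ l) (he_meas : ∀ t, 1 ≤ t → MeasurableSet (e t)) (j : ℕ)
    (htop : μ {ω | busyTime l (erasedSlots e ω) j = ⊤} = 0) (f : ℕ∞ → ENNReal) :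
    ∫⁻ ω, f (busyTime l (erasedSlots e ω) j) ∂μ =
      ∑' s : ℕ, f s * μ {ω | busyTime l (erasedSlots e ω) j = (s : ℕ∞)} := by
  have hA := measurableSet_busyTime_eq (e := e) hl he_meas j
  have hae : ∀ᵐ ω ∂μ, f (busyTime l (erasedSlots e ω) j) =
      ∑' s : ℕ, Set.indicator {ω | busyTime l (erasedSlots e ω) j = (s : ℕ∞)} (fun _ => f s) ω := by
    have : ∀ᵐ ω ∂μ, busyTime l (erasedSlots e ω) j ≠ ⊤ := by
      rw [ae_iff]
      simpa using htop
    filter_upwards [this] with ω hω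
    obtain ⟨s, hs⟩ := ENat.ne_top_iff_exists.1 hω
    have hmem : ω ∈ {ω | busyTime l (erasedSlots e ω) j = (s : ℕ∞)} := hs.symm
    rw [tsum_eq_single s, Set.indicator_of_mem hmem, ← hs]
    intro s' hs'
    refine Set.indicator_of_notMem (fun h => hs' ?_) _
    have : ((s' : ℕ) : ℕ∞) = s := h.symm.trans hs.symm
    exact_mod_cast this
  rw [lintegral_congr_ae hae, lintegral_tsum fun s => (measurable_const.indicator (hA s)).aemeasurable]
  exact tsum_congr fun s => lintegral_indicator_const (hA s) _

/-- Moments of the busy time from sums against its law. -/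
theorem lintegral_busyTime_pow [IsProbabilityMeasure μ] (hl : 1 ≤ l) (hε0 : 0 ≤ ε) (hε1 : ε ≤ 1)
    (he_meas : ∀ t, 1 ≤ t → MeasurableSet (e t))
    (he_indep : iIndepSet (fun n : ℕ => e (n + 1)) μ)
    (he_prob : ∀ t, 1 ≤ t → μ (e t) = ENNReal.ofReal ε) (hle : (l : ℝ) * ε ≤ 1) (j r : ℕ)
    {m : ℝ} (hm : HasSum (fun s : ℕ => (s : ℝ) ^ r * busyPmf l ε s) m) :
    ∫⁻ ω, (busyTime l (erasedSlots e ω) j : ENNReal) ^ r ∂μ = ENNReal.ofReal m := by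
  have hstart := measure_periodStart_ne_top hl hε0 hε1 he_meas he_indep he_prob hle j
  rw [lintegral_busyTime hl he_meas j (measure_busyTime_eq_top_of_periodStart hl hε0 hε1 he_meas
    he_indep he_prob hle hstart) (fun x => (x : ENNReal) ^ r), ← hm.tsum_eq,
    ENNReal.ofReal_tsum_of_nonneg (fun s => mul_nonneg (by positivity)
      (busyPmf_nonneg hl hε0 hε1 s)) hm.summable]
  refine tsum_congr fun s => ?_
  rw [measure_busyTime_eq hl hε0 he_meas he_indep he_prob, hstart, mul_one,
    ENNReal.ofReal_mul (by positivity), ENNReal.ofReal_pow s.cast_nonneg, ENNReal.ofReal_natCast,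
    ENat.toENNReal_coe]

end Law

end LowDelayCode

theorem theorem1 {Ω : Type*} [MeasurableSpace Ω]
    (μ : MeasureTheory.Measure Ω) [MeasureTheory.IsProbabilityMeasure μ]
    (l : ℕ) (hl : 1 ≤ l) (ε : ℝ) (hε0 : 0 ≤ ε) (hε1 : ε ≤ 1)
    (e : ℕ → Set Ω)
    (he_meas : ∀ t, 1 ≤ t → MeasurableSet (e t))
    (he_indep : ProbabilityTheory.iIndepSet (fun n : ℕ => e (n + 1)) μ)
    (he_prob : ∀ t, 1 ≤ t → μ (e t) = ENNReal.ofReal ε) :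
    -- I: finite mean
    ((l : ℝ) * ε < 1 → ∀ j : ℕ,
      ∫⁻ ω, (LowDelayCode.busyTime l (LowDelayCode.erasedSlots e ω) j : ENNReal) ∂μ < ⊤) ∧
    -- II: the law of the busy time, given that the period takes place
    (∀ j s : ℕ,
      μ {ω | LowDelayCode.busyTime l (LowDelayCode.erasedSlots e ω) j = (s : ℕ∞)} =
        ENNReal.ofReal (LowDelayCode.busyPmf l ε s) *
          μ {ω | LowDelayCode.periodStart l (LowDelayCode.erasedSlots e ω) j ≠ ⊤}) ∧
    -- II, continued: up to capacity, every period takes place and ends almost surely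
    ((l : ℝ) * ε ≤ 1 → ∀ j : ℕ,
      μ {ω | LowDelayCode.busyTime l (LowDelayCode.erasedSlots e ω) j = ⊤} = 0 ∧
      ∀ s : ℕ,
        μ {ω | LowDelayCode.busyTime l (LowDelayCode.erasedSlots e ω) j = (s : ℕ∞)} =
          ENNReal.ofReal (LowDelayCode.busyPmf l ε s)) ∧
    -- III: first and second moment
    ((l : ℝ) * ε < 1 → ∀ j : ℕ,
      ∫⁻ ω, (LowDelayCode.busyTime l (LowDelayCode.erasedSlots e ω) j : ENNReal) ∂μ =
        ENNReal.ofReal (((l : ℝ) - 1) * ε * (1 - ε) ^ (l - 1) / (1 - l * ε)) ∧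
      ∫⁻ ω, (LowDelayCode.busyTime l (LowDelayCode.erasedSlots e ω) j : ENNReal) ^ 2 ∂μ =
        ENNReal.ofReal (((l : ℝ) - 1) * ε * (1 - ε) ^ (l - 1) / (1 - l * ε) +
          l * ((l : ℝ) - 1) * ε ^ 2 * (1 - ε) ^ l / (1 - l * ε) ^ 3)) := by
  have hpow := fun (hle : (l : ℝ) * ε ≤ 1) j r m hm =>
    LowDelayCode.lintegral_busyTime_pow (m := m) hl hε0 hε1 he_meas he_indep he_prob hle j r hm
  have hmean : (l : ℝ) * ε < 1 → ∀ j : ℕ,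
      ∫⁻ ω, (LowDelayCode.busyTime l (LowDelayCode.erasedSlots e ω) j : ENNReal) ∂μ =
        ENNReal.ofReal (((l : ℝ) - 1) * ε * (1 - ε) ^ (l - 1) / (1 - l * ε)) := fun hlt j => by
    simpa only [pow_one] using hpow hlt.le j 1 _
      (by simpa only [pow_one] using LowDelayCode.hasSum_id_mul_busyPmf hl hε0 hε1 hlt)
  have hlaw := LowDelayCode.measure_busyTime_eq hl hε0 he_meas he_indep he_prob
  refine ⟨fun hlt j => ?_, hlaw, fun hle j => ?_, fun hlt j => ⟨hmean hlt j, ?_⟩⟩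
  · rw [hmean hlt j]
    exact ENNReal.ofReal_lt_top
  · have hstart := LowDelayCode.measure_periodStart_ne_top hl hε0 hε1 he_meas he_indep he_prob hle j
    exact ⟨LowDelayCode.measure_busyTime_eq_top_of_periodStart hl hε0 hε1 he_meas he_indep he_prob
      hle hstart, fun s => by rw [hlaw, hstart, mul_one]⟩
  · exact hpow hlt.le j 2 _ (LowDelayCode.hasSum_sq_mul_busyPmf hl hε0 hε1 hlt)
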